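/- Let $\mathbb X$ be a set of treatments, $f:\mathbb X\to\mathbb R^p$ ($p\ge 1$) a regression function, and for a design $X=(x_1,\dots,x_n)\in\mathbb X^n$ let $F$ be the $n\times p$ matrix with $i$th row $f(x_i)^T$; only designs with $F^TF$ invertible are considered. Let $q$ be the number of distinct values among $x_1,\dots,x_n$, let $Z$ be the $n\times q$ indicator matrix of these unique treatments, $H_Z=Z(Z^TZ)^{-1}Z^T$, and let $d=n-q$ be the pure-error degrees of freedom. *Loss, weight, posterior.* The sum-of-squares loss is $\ell(t;y,X)=\sum_{i=1}^n (y_i-f(x_i)^Tt)^2$ and the calibration weight is $w=1/(2\tilde\sigma^2)$ with $\tilde\sigma^2=y^T(I_n-H_Z)y/(n-q)$. Under the uniform prior on $\mathbb R^p$ the Gibbs posterior has density $\pi(t\mid y,X)\propto \exp[-w\,\ell(t;y,X)]$. The utilities are $u_{NSE}(t,y,X)=-\|t-m\|_2^2$, where $m$ is the Gibbs posterior mean, and $u_{SH}(t,y,X)=\log\pi(t\mid y,X)$; both are set to $-\infty$ where the Gibbs posterior does not exist (in particular if $d=0$). *Designer distribution.* The hyper-variables $r=(\mu(\cdot),\sigma^2,\kappa)$,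 with $\mu:\mathbb X\to\mathbb R$, have a distribution $\mathcal C$ which does not depend on $X$, with $\kappa>0$ almost surely, $\kappa$ and $\sigma^2$ integrable, and $\mathrm E_{\mathcal C}(\kappa)=\mathrm E_{\mathcal C}(\sigma^2)$ (as is the case if $\mathrm E_{\mathcal C}(\kappa\mid\sigma^2)=\sigma^2$, for instance if $\sigma^2=\mathrm E_{\mathcal C}(\kappa)$ is a constant). Given $r$, the responses under $\mathcal D(r;X)$ are $y_i=\mu(x_i)+e_i$ with $e_1,\dots,e_n$ independent $N(0,\kappa)$. The target parameter value $\theta(r)$ is the minimiser over $t\in\mathbb R^p$ of $\mathrm E_{\mathcal D(r;X)}[w\,\ell(t;y,X)]$ (with finite minimum), or, alternatively, of the unweighted expected loss $\mathrm E_{\mathcal D(r;X)}[\ell(t;y,X)]$. The Gibbs expected utility is $U(X)=\mathrm E_{\mathcal C}\{\mathrm E_{\mathcal D(r;X)}[u(\theta(r),y,X)]\}$, an expectation with values in $[-\infty,\infty]$. Then the following hold for every $n$ and every such design $X$. 1. For every $r$ with $\kappa>0$, $(F^TF)^{-1}F^T(\mu(x_1),\dots,\mu(x_n))^T$ is the unique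 minimiser of the unweighted expected loss and, if $d>2$, also the unique minimiser of the weighted expected loss. 2. The Gibbs expected NSE utility exists and equals $$U_{NSE}(X)=\mathrm E_{\mathcal C}(\sigma^2)\cdot\bigl(-\mathrm{tr}[(F^TF)^{-1}]\,h_1(d)\bigr),\qquad 0<\mathrm E_{\mathcal C}(\sigma^2)<\infty,$$ where $h_1(d)=1$ for $d>0$ and $h_1(0)=\infty$. 3. If moreover $\log\kappa$ is integrable under $\mathcal C$, the Gibbs expected SH utility exists and equals $$U_{SH}(X)=-\frac p2\bigl[\log(2\pi)+\mathrm E_{\mathcal C}(\log\kappa)+\log 2\bigr]+\frac12\bigl(-p\,h_2(d)+\log|F^TF|\bigr),$$ where $h_2(d)=\psi(d/2)-\log d+\frac{d}{d-2}$ for $d>2$, with $\psi$ the digamma function, and $h_2(d)=\infty$ for $d\le 2$. In particular, neither $\mathrm E_{\mathcal C}(\sigma^2)$ nor the additive constant in part 3 depends on the design. -/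

import Mathlib

open MeasureTheory ProbabilityTheory Matrix
open scoped ENNReal NNReal

namespace GibbsDesign

noncomputable section

/-! ### Expectations with values in the extended reals -/

/-- The expectation of the extended-real random variable `g` under `P` exists and equals `a`:
`g` is a.e. measurable, its positive and negative parts do not both have infinite expectation, and
`a = E[g⁺] - E[g⁻]`. -/
def HasExpectation {Ω : Type*} [MeasurableSpace Ω] (P : Measure Ω) (g : Ω → EReal) (a : EReal) :
    Prop :=
  AEMeasurable g P ∧
    ((∫⁻ x, (g x).toENNReal ∂P) ≠ ⊤ ∨ (∫⁻ x, (-g x).toENNReal ∂P) ≠ ⊤) ∧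
    a = ((∫⁻ x, (g x).toENNReal ∂P : ℝ≥0∞) : EReal) - ((∫⁻ x, (-g x).toENNReal ∂P : ℝ≥0∞) : EReal)

/-! ### Gibbs inference with a `p`-dimensional parameter and `n` responses -/

section Gibbs

variable {n p : ℕ}

/-- `‖u‖_V = uᵀ V u`. -/
def quadForm {m : ℕ} (V : Matrix (Fin m) (Fin m) ℝ) (u : Fin m → ℝ) : ℝ := u ⬝ᵥ (V *ᵥ u)

/-- The unnormalised Gibbs posterior density `exp[-w ℓ(t)] π(t)`. -/
def gibbsKernel (w : ℝ) (loss prior : (Fin p → ℝ) → ℝ) (t : Fin p → ℝ) : ℝ :=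
  Real.exp (-(w * loss t)) * prior t

/-- The Gibbs posterior exists: the calibration weight is positive, and the unnormalised density
can be normalised. -/
def GibbsPosteriorExists (w : ℝ) (loss prior : (Fin p → ℝ) → ℝ) : Prop :=
  0 < w ∧ (∫⁻ t, ENNReal.ofReal (gibbsKernel w loss prior t)) ≠ 0 ∧
    (∫⁻ t, ENNReal.ofReal (gibbsKernel w loss prior t)) ≠ ⊤

/-- The Gibbs posterior density with respect to Lebesgue measure. -/
def gibbsPdf (w : ℝ) (loss prior : (Fin p → ℝ) → ℝ) (t : Fin p → ℝ) : ℝ :=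
  gibbsKernel w loss prior t / ∫ s, gibbsKernel w loss prior s

/-- The Gibbs posterior distribution. -/
def gibbsPosterior (w : ℝ) (loss prior : (Fin p → ℝ) → ℝ) : Measure (Fin p → ℝ) :=
  volume.withDensity fun t => ENNReal.ofReal (gibbsPdf w loss prior t)

/-- The Gibbs posterior mean. -/
def gibbsMean (w : ℝ) (loss prior : (Fin p → ℝ) → ℝ) : Fin p → ℝ :=
  ∫ t, t ∂(gibbsPosterior w loss prior)

open Classical in
/-- Negative squared error utility; it is `-∞` if there is no Gibbs posterior. -/
def utilityNSE (w : ℝ) (loss prior : (Fin p → ℝ) → ℝ) (t : Fin p → ℝ) : EReal :=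
  if GibbsPosteriorExists w loss prior then
    ((-quadForm 1 (t - gibbsMean w loss prior) : ℝ) : EReal)
  else ⊥

open Classical in
/-- Shannon information utility; it is `-∞` if there is no Gibbs posterior. -/
def utilitySH (w : ℝ) (loss prior : (Fin p → ℝ) → ℝ) (t : Fin p → ℝ) : EReal :=
  if GibbsPosteriorExists w loss prior then
    ((Real.log (gibbsPdf w loss prior t) : ℝ) : EReal)
  else ⊥

/-- `t` minimises the expected weighted loss `E_D[w(y) ℓ(t; y)]` (of a nonnegative loss), and the
minimum is finite. -/
def IsTarget (D : Measure (Fin n → ℝ)) (w : (Fin n → ℝ) → ℝ)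
    (loss : (Fin p → ℝ) → (Fin n → ℝ) → ℝ) (t : Fin p → ℝ) : Prop :=
  (∫⁻ y, ENNReal.ofReal (w y * loss t y) ∂D) ≠ ⊤ ∧
    ∀ s, (∫⁻ y, ENNReal.ofReal (w y * loss t y) ∂D) ≤ ∫⁻ y, ENNReal.ofReal (w y * loss s y) ∂D

/-- `U` is the expected utility `E_C { E_{D(r)} [u(θ(r), y)] }`, with both expectations existing in
the extended reals. -/
def IsExpectedUtility {R : Type*} [MeasurableSpace R] (C : Measure R)
    (D : R → Measure (Fin n → ℝ)) (u : (Fin p → ℝ) → (Fin n → ℝ) → EReal)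
    (θ : R → Fin p → ℝ) (U : EReal) : Prop :=
  ∃ inner : R → EReal,
    (∀ᵐ r ∂C, HasExpectation (D r) (fun y => u (θ r) y) (inner r)) ∧ HasExpectation C inner U

end Gibbs

/-! ### Linear models: regression function `f : 𝕏 → ℝᵖ` and design `X = (x₁, …, xₙ) ∈ 𝕏ⁿ` -/

section LinearModel

variable {𝕏 : Type*} {n p : ℕ}

/-- The model matrix, whose `i`th row is `f(xᵢ)ᵀ`. -/
def modelMatrix (f : 𝕏 → Fin p → ℝ) (X : Fin n → 𝕏) : Matrix (Fin n) (Fin p) ℝ :=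
  Matrix.of fun i => f (X i)

/-- The number `q` of unique treatments of the design. -/
def numTreatments (X : Fin n → 𝕏) : ℕ := (Set.range X).ncard

/-- The pure error degrees of freedom `d = n - q` (always `q ≤ n`). -/
def pureErrorDF (X : Fin n → 𝕏) : ℕ := n - numTreatments X

open Classical in
/-- The model matrix of the unique-treatment model; its columns are indexed by the unique
treatments. -/
def treatmentMatrix (X : Fin n → 𝕏) : Matrix (Fin n) (Set.range X) ℝ :=
  Matrix.of fun i j => if X i = j then 1 else 0

open Classical in
/-- `H_Z = Z (Zᵀ Z)⁻¹ Zᵀ`. -/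
def treatmentHat (X : Fin n → 𝕏) : Matrix (Fin n) (Fin n) ℝ :=
  treatmentMatrix X * ((treatmentMatrix X)ᵀ * treatmentMatrix X)⁻¹ * (treatmentMatrix X)ᵀ

/-- The pure error estimate of the error variance, `yᵀ (I - H_Z) y / (n - q)`. -/
def pureErrorVar (X : Fin n → 𝕏) (y : Fin n → ℝ) : ℝ :=
  1 / (pureErrorDF X : ℝ) * quadForm (1 - treatmentHat X) y

/-- The calibration weight `w = 1 / (2 σ̃²)`. If `d = 0`, where `σ̃²` is not defined, this is `0`,
which is not an admissible weight in `GibbsPosteriorExists`. -/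
def calibWeight (X : Fin n → 𝕏) (y : Fin n → ℝ) : ℝ := 1 / (2 * pureErrorVar X y)

/-- The sum of squares loss. -/
def ssLoss (f : 𝕏 → Fin p → ℝ) (X : Fin n → 𝕏) (t : Fin p → ℝ) (y : Fin n → ℝ) : ℝ :=
  ∑ i, (y i - f (X i) ⬝ᵥ t) ^ 2

/-- The hyper-variables `r = (μ(·), σ², κ)`. -/
abbrev HyperVar (𝕏 : Type*) : Type _ := (𝕏 → ℝ) × ℝ≥0 × ℝ≥0

/-- The mean response function `μ(·)`. -/
abbrev HyperVar.mean (r : HyperVar 𝕏) : 𝕏 → ℝ := r.1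

/-- The variance `σ²`. -/
abbrev HyperVar.sigmaSq (r : HyperVar 𝕏) : ℝ≥0 := r.2.1

/-- The mixing variance `κ`. -/
abbrev HyperVar.kappa (r : HyperVar 𝕏) : ℝ≥0 := r.2.2

/-- The unique-treatment designer distribution: given `r`, the responses are
`yᵢ = μ(xᵢ) + eᵢ` with `e₁, …, eₙ` independent `N(0, κ)`. -/
def designerDist (X : Fin n → 𝕏) (r : HyperVar 𝕏) : Measure (Fin n → ℝ) :=
  Measure.pi fun i => gaussianReal (HyperVar.mean r (X i)) (HyperVar.kappa r)

/-- `U` is the Gibbs expected NSE utility of the design `X` under the sum of squares loss, the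
calibration weight `1 / (2 σ̃²)` and the uniform prior, evaluated at target values `θ`. -/
def IsGibbsExpectedNSE (f : 𝕏 → Fin p → ℝ) (C : Measure (HyperVar 𝕏)) (X : Fin n → 𝕏)
    (θ : HyperVar 𝕏 → Fin p → ℝ) (U : EReal) : Prop :=
  IsExpectedUtility C (designerDist X)
    (fun t y => utilityNSE (calibWeight X y) (fun s => ssLoss f X s y) (fun _ => 1) t) θ U

/-- The same for the Shannon information utility. -/
def IsGibbsExpectedSH (f : 𝕏 → Fin p → ℝ) (C : Measure (HyperVar 𝕏)) (X : Fin n → 𝕏)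
    (θ : HyperVar 𝕏 → Fin p → ℝ) (U : EReal) : Prop :=
  IsExpectedUtility C (designerDist X)
    (fun t y => utilitySH (calibWeight X y) (fun s => ssLoss f X s y) (fun _ => 1) t) θ U

/-- `h₁(d) = 1` if `d > 0`, and `h₁(0) = ∞`. -/
def h₁ (d : ℕ) : EReal := if d = 0 then ⊤ else 1

/-- `h₂(d) = ψ(d/2) - log d + d/(d-2)` with `ψ` the digamma function if `d > 2`, and `∞` if
`d ≤ 2`. -/
def h₂ (d : ℕ) : EReal :=
  if d ≤ 2 then ⊤
  else (((Complex.digamma ((d : ℂ) / 2)).re - Real.log d + (d : ℝ) / ((d : ℝ) - 2) : ℝ) : EReal)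

/-- `-tr[(FᵀF)⁻¹] h₁(d)`. -/
def objectiveNSE (f : 𝕏 → Fin p → ℝ) (X : Fin n → 𝕏) : EReal :=
  -((((modelMatrix f X)ᵀ * modelMatrix f X)⁻¹.trace : ℝ) : EReal) * h₁ (pureErrorDF X)

/-- `-p h₂(d) + log |FᵀF|`. -/
def objectiveSH (f : 𝕏 → Fin p → ℝ) (X : Fin n → 𝕏) : EReal :=
  -((p : ℝ) : EReal) * h₂ (pureErrorDF X) +
    ((Real.log ((modelMatrix f X)ᵀ * modelMatrix f X).det : ℝ) : EReal)

end LinearModel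

end

end GibbsDesign

/-! Everything rests on one orthogonal decomposition of the responses. The matrix `P = I - H_Z`
(`pureErrorProj`) is an orthogonal projection of trace `d` that annihilates every vector depending
on the treatment alone, hence both the mean vector and the columns of `F`. So `yᵀPy` is `κ` times a
chi-squared variable with `d` degrees of freedom, whatever `μ` is
(`exists_identDistrib_quadForm_piGaussian`). With `L = (FᵀF)⁻¹Fᵀ` also `P Lᵀ = 0`, so the weight, a
function of `Py`, is independent of the least squares estimate `Ly` (`indepFun_mulVec_piGaussian`,
`lintegral_calibWeight_mul`).

Completing the square (`ssLoss_eq_min_add`) shows that the Gibbs posterior is normal with mean `Ly`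
and precision `2w FᵀF`. In the expected weighted loss the pure error contributes the constant `d/2`,
and the rest factors as `E(w)` times a quadratic in `t` that is minimal at `L` applied to the mean
vector. This is the unique target when `d > 2`. For `d = 1, 2` one has `E(w) = ∞` and no finite
minimum.

At the target, the NSE utility has conditional mean `-κ tr[(FᵀF)⁻¹]`, and `E(κ) = E(σ²)`. The
logarithm of the posterior density needs only `E log χ² = log 2 + ψ(d/2)` and `E(1/χ²) = 1/(d-2)`,
the latter infinite for `d = 1, 2`. In the quadratic term `κ` cancels against the weight, so `κ`
survives only through `E(log κ)`. -/

namespace GibbsDesign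

/-! ### Chi-squared moments from polar coordinates. -/

section ChiSquare

lemma polar_weight_rpow {d : ℕ} (hd : 1 ≤ d) (s : ℝ) {r : ℝ} (hr : 0 < r) :
    r ^ (d - 1) * (Real.exp (-(1 / 2) * r ^ 2) * (r ^ 2) ^ s) =
      r ^ ((d : ℝ) - 1 + 2 * s) * Real.exp (-(1 / 2) * r ^ (2 : ℝ)) := by
  rw [Real.rpow_add hr, Real.rpow_mul hr.le, Real.rpow_two, ← Real.rpow_natCast,
    Nat.cast_sub hd, Nat.cast_one]
  ring

variable {E : Type*} [NormedAddCommGroup E] [InnerProductSpace ℝ E] [FiniteDimensional ℝ E]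
  [MeasurableSpace E] [BorelSpace E]

open Module in
/-- The standard Gaussian measure on a Euclidean space has the usual Lebesgue density. -/
lemma stdGaussian_eq_withDensity :
    stdGaussian E = volume.withDensity fun x : E =>
      ENNReal.ofReal ((2 * Real.pi) ^ (-(finrank ℝ E / 2 : ℝ)) * Real.exp (-(1 / 2) * ‖x‖ ^ 2)) := by
  have hint : Integrable fun x : E => Real.exp (-(1 / 2) * ‖x‖ ^ 2) := by
    have := (GaussianFourier.integrable_cexp_neg_mul_sq_norm_add (V := E) (b := 1 / 2)
      (by norm_num) 0 0).re
    refine this.congr (.of_forall fun x => ?_)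
    have : -(1 / 2 : ℂ) * ‖x‖ ^ 2 = ((-(1 / 2) * ‖x‖ ^ 2 : ℝ) : ℂ) := by push_cast; ring
    simp only [zero_mul, add_zero, this, ← Complex.ofReal_exp, RCLike.re_eq_complex_re,
      Complex.ofReal_re]
  have := isFiniteMeasure_withDensity_ofReal
    (hint.const_mul ((2 * Real.pi) ^ (-(finrank ℝ E / 2 : ℝ)))).2
  apply Measure.ext_of_charFun
  ext t
  rw [charFun_stdGaussian, charFun_apply,
    integral_withDensity_eq_integral_toReal_smul (by fun_prop) (by simp)]
  have h := GaussianFourier.integral_cexp_neg_mul_sq_norm_add (V := E) (b := 1 / 2)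
      (by norm_num) Complex.I t
  have h2 : (((2 * Real.pi) ^ (-(finrank ℝ E / 2 : ℝ)) : ℝ) : ℂ) *
      (Real.pi / (1 / 2) : ℂ) ^ (finrank ℝ E / 2 : ℂ) = 1 := by
    have : (Real.pi / (1 / 2) : ℂ) = ((2 * Real.pi : ℝ) : ℂ) := by push_cast; ring
    rw [this, show (finrank ℝ E / 2 : ℂ) = ((finrank ℝ E / 2 : ℝ) : ℂ) by push_cast; rfl,
      ← Complex.ofReal_cpow (by positivity), ← Complex.ofReal_mul, ← Real.rpow_add (by positivity)]
    simp
  calc Complex.exp (-‖t‖ ^ 2 / 2)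
      = (((2 * Real.pi) ^ (-(finrank ℝ E / 2 : ℝ)) : ℝ) : ℂ) *
        ∫ v : E, Complex.exp (-(1 / 2) * ‖v‖ ^ 2 + Complex.I * inner ℝ t v) := by
        rw [h, ← mul_assoc, h2, one_mul]
        congr 1
        rw [Complex.I_sq]; ring
    _ = _ := by
        rw [← integral_const_mul]
        congr 1
        ext x
        rw [ENNReal.toReal_ofReal (by positivity), Complex.real_smul, Complex.exp_add,
          real_inner_comm]
        push_cast
        rw [mul_assoc, mul_comm Complex.I]

variable [Nontrivial E]

-- Polar coordinates turn radial Gaussian integrals into one-dimensional ones; both the finite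
-- moments and the divergence for `d ≤ 2` are read off from this.
open Module in
lemma integrable_fun_norm_stdGaussian_iff {f : ℝ → ℝ} :
    Integrable (fun x : E => f ‖x‖) (stdGaussian E) ↔
      IntegrableOn (fun r : ℝ => r ^ (finrank ℝ E - 1) * (Real.exp (-(1 / 2) * r ^ 2) * f r))
        (Set.Ioi 0) := by
  rw [stdGaussian_eq_withDensity, integrable_withDensity_iff_integrable_smul' (by fun_prop) (by simp)]
  have : ∀ x : E, (ENNReal.ofReal ((2 * Real.pi) ^ (-(finrank ℝ E / 2 : ℝ)) *
      Real.exp (-(1 / 2) * ‖x‖ ^ 2))).toReal • f ‖x‖ = (2 * Real.pi) ^ (-(finrank ℝ E / 2 : ℝ)) *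
      (Real.exp (-(1 / 2) * ‖x‖ ^ 2) * f ‖x‖) := fun x => by
    rw [ENNReal.toReal_ofReal (by positivity), smul_eq_mul, mul_assoc]
  simp_rw [this]
  rw [integrable_const_mul_iff (IsUnit.mk0 _ (by positivity)),
    integrable_fun_norm_addHaar volume (f := fun r => Real.exp (-(1 / 2) * r ^ 2) * f r)]
  simp only [smul_eq_mul]

-- The constant stays anonymous: total mass one determines it later.
open Module in
lemma exists_integral_fun_norm_stdGaussian :
    ∃ c : ℝ, ∀ f : ℝ → ℝ, ∫ x : E, f ‖x‖ ∂(stdGaussian E) =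
      c * ∫ r in Set.Ioi (0 : ℝ), r ^ (finrank ℝ E - 1) * (Real.exp (-(1 / 2) * r ^ 2) * f r) := by
  refine ⟨(2 * Real.pi) ^ (-(finrank ℝ E / 2 : ℝ)) *
    (finrank ℝ E * volume.real (Metric.ball (0 : E) 1)), fun f => ?_⟩
  rw [stdGaussian_eq_withDensity, integral_withDensity_eq_integral_toReal_smul (by fun_prop) (by simp)]
  have : ∀ x : E, (ENNReal.ofReal ((2 * Real.pi) ^ (-(finrank ℝ E / 2 : ℝ)) *
      Real.exp (-(1 / 2) * ‖x‖ ^ 2))).toReal • f ‖x‖ = (2 * Real.pi) ^ (-(finrank ℝ E / 2 : ℝ)) *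
      (Real.exp (-(1 / 2) * ‖x‖ ^ 2) * f ‖x‖) := fun x => by
    rw [ENNReal.toReal_ofReal (by positivity), smul_eq_mul, mul_assoc]
  simp_rw [this]
  rw [integral_const_mul,
    integral_fun_norm_addHaar volume (fun r => Real.exp (-(1 / 2) * r ^ 2) * f r)]
  simp only [smul_eq_mul, nsmul_eq_mul]
  ring

open Module in
/-- Integrability of the powers of a chi-squared variable. -/
lemma integrable_normSq_rpow_stdGaussian {s : ℝ} (hs : 0 < (finrank ℝ E : ℝ) / 2 + s) :
    Integrable (fun x : E => (‖x‖ ^ 2) ^ s) (stdGaussian E) := by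
  rw [integrable_fun_norm_stdGaussian_iff (f := fun r => (r ^ 2) ^ s)]
  refine (integrableOn_rpow_mul_exp_neg_mul_rpow (p := 2) (b := 1 / 2)
    (s := (finrank ℝ E : ℝ) - 1 + 2 * s) (by linarith) (by norm_num) (by norm_num)).congr_fun
      (fun r hr => ?_) measurableSet_Ioi
  rw [polar_weight_rpow finrank_pos s hr]

open Module in
/-- The moments of a chi-squared variable. -/
lemma integral_normSq_rpow_stdGaussian {s : ℝ} (hs : 0 < (finrank ℝ E : ℝ) / 2 + s) :
    ∫ x : E, (‖x‖ ^ 2) ^ s ∂(stdGaussian E) =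
      2 ^ s * (Real.Gamma ((finrank ℝ E : ℝ) / 2 + s) / Real.Gamma ((finrank ℝ E : ℝ) / 2)) := by
  obtain ⟨c, hc⟩ := exists_integral_fun_norm_stdGaussian (E := E)
  have hd : 0 < (finrank ℝ E : ℝ) := by exact_mod_cast finrank_pos
  have key : ∀ s : ℝ, 0 < (finrank ℝ E : ℝ) / 2 + s →
      ∫ x : E, (‖x‖ ^ 2) ^ s ∂(stdGaussian E) =
        c * ((1 / 2) ^ (-((finrank ℝ E : ℝ) / 2 + s)) * (1 / 2) *
          Real.Gamma ((finrank ℝ E : ℝ) / 2 + s)) := by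
    intro s hs
    rw [hc (fun r => (r ^ 2) ^ s), setIntegral_congr_fun measurableSet_Ioi
      (fun r hr => polar_weight_rpow finrank_pos s hr),
      integral_rpow_mul_exp_neg_mul_rpow (by norm_num) (by linarith) (by norm_num)]
    congr 4 <;> ring
  -- The zeroth moment is 1, which fixes `c` in terms of `Γ(d/2)`.
  have h0 := key 0 (by linarith)
  simp only [Real.rpow_zero, integral_const, probReal_univ, smul_eq_mul, mul_one, add_zero] at h0
  have hG : Real.Gamma ((finrank ℝ E : ℝ) / 2) ≠ 0 := (Real.Gamma_pos_of_pos (by linarith)).ne'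
  rw [key s hs, neg_add, Real.rpow_add (by norm_num)]
  have h2 : ((1 / 2 : ℝ)) ^ (-s) = 2 ^ s := by
    rw [one_div, Real.inv_rpow (by norm_num), Real.rpow_neg (by norm_num), inv_inv]
  rw [h2]
  generalize Real.Gamma ((finrank ℝ E : ℝ) / 2 + s) = g at *
  generalize Real.Gamma ((finrank ℝ E : ℝ) / 2) = g' at *
  rw [mul_div_assoc' (2 ^ s) g g', eq_div_iff hG]
  linear_combination (-(2 : ℝ) ^ s * g) * h0

open Module in
/-- The inverse of a chi-squared variable with at most two degrees of freedom has no mean. -/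
lemma not_integrable_inv_normSq_stdGaussian (h : finrank ℝ E ≤ 2) :
    ¬ Integrable (fun x : E => (‖x‖ ^ 2)⁻¹) (stdGaussian E) := by
  rw [integrable_fun_norm_stdGaussian_iff (f := fun r => (r ^ 2)⁻¹)]
  intro hi
  have h1 : 1 ≤ finrank ℝ E := finrank_pos
  have h' := hi.mono_set (Set.Ioo_subset_Ioi_self : Set.Ioo (0 : ℝ) 1 ⊆ Set.Ioi 0)
  -- On `(0, 1)` the radial integrand dominates a multiple of `1/r`: the exponential is at least
  -- `exp(-1/2)`, and `r ^ (d - 1) ≥ r` because `d ≤ 2`.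
  have h3 : IntegrableOn (fun r : ℝ => r ^ (-1 : ℝ)) (Set.Ioo 0 1) := by
    refine Integrable.mono' (h'.const_mul (Real.exp (1 / 2))) ?_ ?_
    · exact (measurable_id.pow_const _).aestronglyMeasurable
    · filter_upwards [ae_restrict_mem measurableSet_Ioo] with r hr
      have hr0 : 0 < r := hr.1
      rw [Real.norm_of_nonneg (by positivity), Real.rpow_neg_one]
      have e1 : 1 ≤ Real.exp (1 / 2) * Real.exp (-(1 / 2) * r ^ 2) := by
        rw [← Real.exp_add, Real.one_le_exp_iff]
        nlinarith [hr.2]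
      have e2 : r⁻¹ ≤ r ^ (finrank ℝ E - 1) * (r ^ 2)⁻¹ := by
        have : r ≤ r ^ (finrank ℝ E - 1) := by
          simpa using pow_le_pow_of_le_one hr0.le hr.2.le (show finrank ℝ E - 1 ≤ 1 by omega)
        calc r⁻¹ = r * (r ^ 2)⁻¹ := by field_simp
          _ ≤ _ := by gcongr
      calc r⁻¹ ≤ 1 * (r ^ (finrank ℝ E - 1) * (r ^ 2)⁻¹) := by rwa [one_mul]
        _ ≤ (Real.exp (1 / 2) * Real.exp (-(1 / 2) * r ^ 2)) *
            (r ^ (finrank ℝ E - 1) * (r ^ 2)⁻¹) := by gcongr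
        _ = _ := by ring
  rw [intervalIntegral.integrableOn_Ioo_rpow_iff zero_lt_one] at h3
  exact lt_irrefl _ h3

/-- A standard Gaussian vector is almost surely nonzero. -/
lemma ae_ne_zero_stdGaussian : ∀ᵐ x ∂(stdGaussian E), x ≠ 0 := by
  rw [stdGaussian_eq_withDensity]
  refine (withDensity_absolutelyContinuous _ _).ae_le ?_
  exact Measure.ae_ne volume 0

open Module in
/-- The mean of the logarithm of a chi-squared variable. -/
lemma integral_log_normSq_stdGaussian :
    Integrable (fun x : E => Real.log (‖x‖ ^ 2)) (stdGaussian E) ∧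
    ∫ x : E, Real.log (‖x‖ ^ 2) ∂(stdGaussian E) =
      Real.log 2 + (Complex.digamma ((finrank ℝ E : ℂ) / 2)).re := by
  have hd : 0 < (finrank ℝ E : ℝ) := by exact_mod_cast finrank_pos
  set a : ℝ := (finrank ℝ E : ℝ) / 2 with ha
  have ha0 : 0 < a := by positivity
  -- The moment generating function of `log ‖x‖²` at `s` is the moment of order `s` of `‖x‖²`; its
  -- derivative at 0 is the mean of the logarithm. The identity holds only off the origin, where
  -- `log 0 = 0` would spoil it.
  have hexp : ∀ s : ℝ, (fun x : E => Real.exp (s * Real.log (‖x‖ ^ 2))) =ᵐ[stdGaussian E]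
      fun x => (‖x‖ ^ 2) ^ s := fun s => by
    filter_upwards [ae_ne_zero_stdGaussian (E := E)] with x hx
    rw [Real.rpow_def_of_pos (by positivity), mul_comm]
  have hmem : Set.Ioi (-a) ⊆ integrableExpSet (fun x : E => Real.log (‖x‖ ^ 2)) (stdGaussian E) :=
    fun s hs => (integrable_normSq_rpow_stdGaussian (by have := Set.mem_Ioi.1 hs; linarith)).congr
      (hexp s).symm
  have h0 : (0 : ℝ) ∈ interior
      (integrableExpSet (fun x : E => Real.log (‖x‖ ^ 2)) (stdGaussian E)) :=
    interior_mono hmem (by rw [interior_Ioi]; simpa using ha0)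
  have hmgf : mgf (fun x : E => Real.log (‖x‖ ^ 2)) (stdGaussian E) =ᶠ[nhds 0]
      fun s => 2 ^ s * (Real.Gamma (a + s) / Real.Gamma a) := by
    filter_upwards [Ioi_mem_nhds (show -a < 0 by linarith)] with s hs
    rw [mgf, integral_congr_ae (hexp s),
      integral_normSq_rpow_stdGaussian (by have := Set.mem_Ioi.1 hs; linarith)]
  refine ⟨integrable_of_mem_interior_integrableExpSet h0, ?_⟩
  have hG : Real.Gamma a ≠ 0 := (Real.Gamma_pos_of_pos ha0).ne'
  have hCd : HasDerivAt Complex.Gamma (deriv Complex.Gamma (a : ℂ)) (a : ℂ) := by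
    refine (Complex.differentiableAt_Gamma _ fun m hm => ?_).hasDerivAt
    have := congrArg Complex.re hm
    simp only [Complex.ofReal_re, Complex.neg_re, Complex.natCast_re] at this
    have : (0 : ℝ) ≤ m := by positivity
    linarith
  have hRd : HasDerivAt Real.Gamma (deriv Complex.Gamma (a : ℂ)).re a := by
    exact hCd.real_of_complex
  have hd1 : HasDerivAt (fun s : ℝ => (2 : ℝ) ^ s * (Real.Gamma (a + s) / Real.Gamma a))
      (Real.log 2 + (deriv Complex.Gamma (a : ℂ)).re / Real.Gamma a) 0 := by
    have e1 : HasDerivAt (fun s : ℝ => (2 : ℝ) ^ s) (Real.log 2) 0 := by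
      simpa using (Real.hasStrictDerivAt_const_rpow (a := 2) (by norm_num) 0).hasDerivAt
    have e2 : HasDerivAt (fun s : ℝ => Real.Gamma (a + s)) (deriv Complex.Gamma (a : ℂ)).re 0 :=
      HasDerivAt.comp_const_add a 0 (by simpa using hRd)
    refine (e1.mul (e2.div_const (Real.Gamma a))).congr_deriv ?_
    simp [hG]
  rw [← deriv_mgf_zero h0, hmgf.deriv_eq, hd1.deriv, Complex.digamma_def, logDeriv_apply]
  have : (finrank ℝ E : ℂ) / 2 = ((a : ℝ) : ℂ) := by rw [ha]; push_cast; rfl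
  rw [this, Complex.Gamma_ofReal, Complex.div_ofReal_re]

open Module in
/-- The mean of the inverse of a chi-squared variable with more than two degrees of freedom. -/
lemma integral_inv_normSq_stdGaussian (h : 2 < finrank ℝ E) :
    Integrable (fun x : E => (‖x‖ ^ 2)⁻¹) (stdGaussian E) ∧
    ∫ x : E, (‖x‖ ^ 2)⁻¹ ∂(stdGaussian E) = 1 / ((finrank ℝ E : ℝ) - 2) := by
  have hd : (2 : ℝ) < finrank ℝ E := by exact_mod_cast h
  have hs : 0 < (finrank ℝ E : ℝ) / 2 + (-1) := by linarith
  have h1 := integrable_normSq_rpow_stdGaussian (E := E) hs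
  have h2 := integral_normSq_rpow_stdGaussian (E := E) hs
  simp only [Real.rpow_neg_one] at h1 h2
  refine ⟨h1, h2.trans ?_⟩
  -- The quotient `Γ(d/2 - 1) / Γ(d/2)` collapses to `1 / (d/2 - 1)`.
  have hG := Real.Gamma_add_one (s := (finrank ℝ E : ℝ) / 2 + -1) hs.ne'
  rw [neg_add_cancel_right] at hG
  have := (Real.Gamma_pos_of_pos hs).ne'
  have h3 : (finrank ℝ E : ℝ) - 2 ≠ 0 := by linarith
  rw [hG, div_mul_cancel_right₀ this, ← mul_inv, one_div]
  congr 1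
  ring

end ChiSquare

/-- The orthogonal projection of a standard Gaussian vector on a subspace is standard Gaussian. -/
lemma stdGaussian_map_orthogonalProjectionOnto {E : Type*} [NormedAddCommGroup E]
    [InnerProductSpace ℝ E] [FiniteDimensional ℝ E] [MeasurableSpace E] [BorelSpace E]
    (K : Submodule ℝ E) :
    (stdGaussian E).map K.orthogonalProjectionOnto = stdGaussian K := by
  have : IsProbabilityMeasure ((stdGaussian E).map K.orthogonalProjectionOnto) :=
    Measure.isProbabilityMeasure_map (by fun_prop)
  apply Measure.ext_of_charFun
  ext t
  rw [charFun_apply, integral_map (by fun_prop) (by fun_prop)]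
  -- For `t ∈ K` pairing with the projection of `x` is pairing with `x`, so the characteristic
  -- functions agree.
  simp_rw [Submodule.inner_orthogonalProjectionOnto_eq_of_mem_right]
  rw [← charFun_apply, charFun_stdGaussian, charFun_stdGaussian, Submodule.coe_norm]

/-! ### Linear and quadratic functions of independent homoscedastic Gaussian responses. -/

section PiGaussian

variable {n : ℕ}

/-- The distribution of independent Gaussian variables with means `m i` and common variance `v`. -/
noncomputable abbrev piGaussian (m : Fin n → ℝ) (v : ℝ≥0) : Measure (Fin n → ℝ) :=
  Measure.pi fun i => gaussianReal (m i) v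

lemma map_piGaussian_zero_one (m : Fin n → ℝ) (v : ℝ≥0) :
    (piGaussian (0 : Fin n → ℝ) 1).map (fun z i => m i + √(v : ℝ) * z i) = piGaussian m v := by
  have h : ∀ i, (gaussianReal ((0 : Fin n → ℝ) i) 1).map (fun x => m i + √(v : ℝ) * x) =
      gaussianReal (m i) v := fun i => by
    have : (fun x => m i + √(v : ℝ) * x) = (fun x => m i + x) ∘ (fun x => √(v : ℝ) * x) := rfl
    rw [this, ← Measure.map_map (by fun_prop) (by fun_prop), gaussianReal_map_const_mul,
      gaussianReal_map_const_add]
    congr 1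
    · simp
    · ext; simp
  have hsf : ∀ i, SigmaFinite ((gaussianReal ((0 : Fin n → ℝ) i) 1).map
      (fun x => m i + √(v : ℝ) * x)) := fun i => by rw [h i]; infer_instance
  unfold piGaussian
  rw [Measure.pi_map_pi (f := fun i x => m i + √(v : ℝ) * x) (fun i => by fun_prop)]
  simp_rw [h]

lemma memLp_eval_piGaussian (m : Fin n → ℝ) (v : ℝ≥0) (i : Fin n) :
    MemLp (fun y : Fin n → ℝ => y i) 2 (piGaussian m v) :=
  (memLp_id_gaussianReal 2).comp_measurePreserving (measurePreserving_eval _ i)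

lemma integral_eval_piGaussian (m : Fin n → ℝ) (v : ℝ≥0) (i : Fin n) :
    ∫ y, y i ∂(piGaussian m v) = m i := by
  rw [integral_eval, integral_id_gaussianReal]

lemma covariance_eval_piGaussian (m : Fin n → ℝ) (v : ℝ≥0) (i j : Fin n) :
    cov[fun y => y i, fun y => y j; piGaussian m v] = if i = j then (v : ℝ) else 0 := by
  split_ifs with h
  · subst h
    rw [covariance_self (measurable_pi_apply i).aemeasurable, ← variance_id_gaussianReal (μ := m i) (v := v)]
    exact (measurePreserving_eval (fun i => gaussianReal (m i) v) i).variance_fun_comp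
      (f := id) (by fun_prop)
  · refine IndepFun.covariance_eq_zero ?_ (memLp_eval_piGaussian m v i) (memLp_eval_piGaussian m v j)
    exact (iIndepFun_pi (μ := fun i => gaussianReal (m i) v) (X := fun _ x => x)
      (fun _ => aemeasurable_id)).indepFun h

/-- Linear images of independent homoscedastic Gaussian variables are independent if they are
orthogonal. -/
lemma indepFun_mulVec_piGaussian {k l : ℕ} (m : Fin n → ℝ) (v : ℝ≥0)
    (A : Matrix (Fin k) (Fin n) ℝ) (B : Matrix (Fin l) (Fin n) ℝ) (hAB : A * Bᵀ = 0) :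
    IndepFun (fun y => A *ᵥ y) (fun y => B *ᵥ y) (piGaussian m v) := by
  have hG : HasGaussianLaw (fun y : Fin n → ℝ => fun i => y i) (piGaussian m v) :=
    iIndepFun.hasGaussianLaw (X := fun i (y : Fin n → ℝ) => y i)
      (fun i => ⟨by
        have := (measurePreserving_eval (fun i => gaussianReal (m i) v) i).map_eq
        change IsGaussian (Measure.map (Function.eval i) (piGaussian m v))
        rw [this]; infer_instance⟩)
      (iIndepFun_pi (μ := fun i => gaussianReal (m i) v) (X := fun _ x => x)
        (fun _ => aemeasurable_id))
  -- The pair `(Ay, By)` is jointly Gaussian, so vanishing cross-covariances give independence;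
  -- these are the entries of `v A Bᵀ`.
  have hL := hG.map ((LinearMap.toContinuousLinearMap A.mulVecLin).prod
    (LinearMap.toContinuousLinearMap B.mulVecLin))
  refine HasGaussianLaw.indepFun_of_covariance_eval
    (X := fun i y => (A *ᵥ y) i) (Y := fun j y => (B *ᵥ y) j) hL fun i j => ?_
  simp_rw [mulVec, dotProduct]
  rw [covariance_fun_sum_fun_sum
    (fun a => (memLp_eval_piGaussian m v a).const_mul _)
    (fun a => (memLp_eval_piGaussian m v a).const_mul _)]
  simp_rw [covariance_const_mul_left, covariance_const_mul_right, covariance_eval_piGaussian]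
  have := congrFun (congrFun hAB i) j
  simp only [mul_apply, transpose_apply, Matrix.zero_apply] at this
  simp only [mul_ite, mul_zero, Finset.sum_ite_eq, Finset.mem_univ, if_true]
  calc ∑ x, A i x * (B j x * (v : ℝ)) = (∑ x, A i x * B j x) * v := by
        rw [Finset.sum_mul]; exact Finset.sum_congr rfl fun x _ => by ring
    _ = 0 := by rw [this, zero_mul]

@[fun_prop]
lemma continuous_quadForm (V : Matrix (Fin n) (Fin n) ℝ) : Continuous (quadForm V) := by
  unfold quadForm
  fun_prop

lemma quadForm_eq_sum (V : Matrix (Fin n) (Fin n) ℝ) (u : Fin n → ℝ) :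
    quadForm V u = ∑ i, ∑ j, V i j * (u i * u j) := by
  simp only [quadForm, dotProduct, mulVec, Finset.mul_sum]
  exact Finset.sum_congr rfl fun i _ => Finset.sum_congr rfl fun j _ => by ring

/-- The mean of a quadratic form. -/
lemma integral_quadForm_piGaussian (m c : Fin n → ℝ) (v : ℝ≥0) (V : Matrix (Fin n) (Fin n) ℝ) :
    Integrable (fun y => quadForm V (y - c)) (piGaussian m v) ∧
    ∫ y, quadForm V (y - c) ∂(piGaussian m v) = v * V.trace + quadForm V (m - c) := by
  have hm : ∀ i, MemLp (fun y : Fin n → ℝ => y i - c i) 2 (piGaussian m v) := fun i =>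
    (memLp_eval_piGaussian m v i).sub (memLp_const _)
  have hi : ∀ i j, Integrable (fun y : Fin n → ℝ => (y i - c i) * (y j - c j))
    (piGaussian m v) := fun i j => (hm i).integrable_mul (hm j)
  have hE : ∀ i, ∫ y, (y i - c i) ∂(piGaussian m v) = m i - c i := fun i => by
    rw [integral_sub ((memLp_eval_piGaussian m v i).integrable one_le_two) (integrable_const _),
      integral_eval_piGaussian]
    simp
  have hval : ∀ i j, ∫ y, (y i - c i) * (y j - c j) ∂(piGaussian m v) =
      (if i = j then (v : ℝ) else 0) + (m i - c i) * (m j - c j) := fun i j => by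
    have h := covariance_eq_sub (hm i) (hm j)
    rw [covariance_sub_const_left ((memLp_eval_piGaussian m v i).integrable one_le_two),
      covariance_sub_const_right ((memLp_eval_piGaussian m v j).integrable one_le_two),
      covariance_eval_piGaussian, hE, hE] at h
    rw [h]
    simp
  simp_rw [quadForm_eq_sum, Pi.sub_apply]
  have hint : ∀ i j, Integrable (fun y : Fin n → ℝ => V i j * ((y i - c i) * (y j - c j)))
    (piGaussian m v) := fun i j => (hi i j).const_mul _
  refine ⟨integrable_finsetSum _ fun i _ => integrable_finsetSum _ fun j _ => hint i j, ?_⟩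
  rw [integral_finsetSum _ fun i _ => integrable_finsetSum _ fun j _ => hint i j]
  simp_rw [integral_finsetSum _ fun j _ => hint _ j, integral_const_mul, hval, mul_add,
    Finset.sum_add_distrib]
  congr 1
  simp [trace, Finset.mul_sum, mul_comm]

/-- The quadratic form of an orthogonal projection matrix in standard Gaussian variables is
distributed as the squared norm of a standard Gaussian vector. -/
lemma exists_identDistrib_quadForm (P : Matrix (Fin n) (Fin n) ℝ) (hsymm : Pᵀ = P)
    (hidem : P * P = P) {d : ℕ} (hd : P.trace = d) :
    ∃ K : Submodule ℝ (EuclideanSpace ℝ (Fin n)), Module.finrank ℝ K = d ∧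
      IdentDistrib (fun x : K => ‖x‖ ^ 2) (quadForm P) (stdGaussian K) (piGaussian 0 1) := by
  set T := toEuclideanCLM (𝕜 := ℝ) P with hT
  have hstar : IsStarProjection T := by
    refine ⟨?_, ?_⟩
    · rw [IsIdempotentElem, hT, ← map_mul, hidem]
    · rw [IsSelfAdjoint, hT, ← map_star, star_eq_conjTranspose, conjTranspose_eq_transpose_of_trivial,
        hsymm]
  obtain ⟨_, hTK⟩ := isStarProjection_iff_eq_starProjection_range.1 hstar
  set K := (T : EuclideanSpace ℝ (Fin n) →ₗ[ℝ] EuclideanSpace ℝ (Fin n)).range with hK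
  -- A self-adjoint idempotent is the orthogonal projection on its range `K`, so `zᵀPz = ‖Pz‖²`.
  have hnorm : ∀ z : Fin n → ℝ,
      ‖K.orthogonalProjectionOnto (WithLp.toLp 2 z)‖ ^ 2 = quadForm P z := fun z => by
    rw [← Submodule.norm_coe, ← Submodule.starProjection_apply, ← hTK, hT, toEuclideanCLM_toLp,
      EuclideanSpace.real_norm_sq_eq]
    have : quadForm P z = (P *ᵥ z) ⬝ᵥ (P *ᵥ z) := by
      rw [quadForm, dotProduct_mulVec (P *ᵥ z), vecMul_mulVec, ← dotProduct_mulVec]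
      rw [hsymm, hidem]
    rw [this]
    simp [dotProduct, sq]
  refine ⟨K, ?_, ?_⟩
  -- The dimension of `K` is the trace of the projection.
  · have hproj : LinearMap.IsProj K (T : EuclideanSpace ℝ (Fin n) →ₗ[ℝ] _) := by
      refine ⟨fun x => ⟨x, rfl⟩, ?_⟩
      rintro _ ⟨x, rfl⟩
      have := DFunLike.congr_fun hstar.1.eq x
      simpa using this
    have h := hproj.trace
    have h' : LinearMap.trace ℝ _ (T : EuclideanSpace ℝ (Fin n) →ₗ[ℝ] EuclideanSpace ℝ (Fin n)) =
        P.trace := by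
      rw [← Matrix.trace_toLin'_eq P,
        ← LinearMap.trace_conj' _ (WithLp.linearEquiv 2 ℝ (Fin n → ℝ)).symm]
      rfl
    rw [h', hd] at h
    exact_mod_cast h.symm
  · refine ⟨by fun_prop, by fun_prop, ?_⟩
    rw [← stdGaussian_map_orthogonalProjectionOnto, Measure.map_map (by fun_prop) (by fun_prop),
      ← map_pi_eq_stdGaussian, Measure.map_map (by fun_prop) (by fun_prop)]
    congr 1
    ext z
    simpa using hnorm z

/-- By symmetry of `P` the cross terms vanish along with `P m`. This removes the mean from the pure
error. -/
lemma quadForm_add_smul {P : Matrix (Fin n) (Fin n) ℝ} (hsymm : Pᵀ = P) {m : Fin n → ℝ}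
    (hm : P *ᵥ m = 0) (a : ℝ) (z : Fin n → ℝ) :
    quadForm P (m + a • z) = a ^ 2 * quadForm P z := by
  have h : m ⬝ᵥ P *ᵥ z = 0 := by
    rw [dotProduct_mulVec, ← mulVec_transpose, hsymm, hm, zero_dotProduct]
  simp only [quadForm, mulVec_add, hm, mulVec_smul, zero_add, add_dotProduct, dotProduct_smul,
    smul_dotProduct, h, smul_eq_mul]
  ring

/-- The quadratic form of an orthogonal projection matrix which annihilates the mean is
distributed as a multiple of a chi-squared variable. -/
lemma exists_identDistrib_quadForm_piGaussian {P : Matrix (Fin n) (Fin n) ℝ} (hsymm : Pᵀ = P)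
    (hidem : P * P = P) {d : ℕ} (hd : P.trace = d) {m : Fin n → ℝ} (hm : P *ᵥ m = 0) (v : ℝ≥0) :
    ∃ K : Submodule ℝ (EuclideanSpace ℝ (Fin n)), Module.finrank ℝ K = d ∧
      IdentDistrib (fun x : K => (v : ℝ) * ‖x‖ ^ 2) (quadForm P) (stdGaussian K)
        (piGaussian m v) := by
  obtain ⟨K, hK, h⟩ := exists_identDistrib_quadForm P hsymm hidem hd
  refine ⟨K, hK, (h.comp (measurable_const_mul (v : ℝ))).trans ?_⟩
  refine ⟨by fun_prop, by fun_prop, ?_⟩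
  rw [← map_piGaussian_zero_one m v, Measure.map_map (by fun_prop) (by fun_prop)]
  congr 1
  ext z
  have := quadForm_add_smul hsymm hm √(v : ℝ) z
  rw [Real.sq_sqrt v.coe_nonneg] at this
  exact this.symm

lemma ae_quadForm_pos_piGaussian {P : Matrix (Fin n) (Fin n) ℝ} (hsymm : Pᵀ = P)
    (hidem : P * P = P) {d : ℕ} (hd : P.trace = d) (hd0 : 0 < d) {m : Fin n → ℝ}
    (hm : P *ᵥ m = 0) {v : ℝ≥0} (hv : 0 < v) :
    ∀ᵐ y ∂(piGaussian m v), 0 < quadForm P y := by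
  obtain ⟨K, hK, h⟩ := exists_identDistrib_quadForm_piGaussian hsymm hidem hd hm v
  have : Nontrivial K := Module.nontrivial_of_finrank_pos (R := ℝ) (hK ▸ hd0)
  refine h.ae_snd (p := fun s => 0 < s) measurableSet_Ioi ?_
  filter_upwards [ae_ne_zero_stdGaussian (E := K)] with x hx
  have : (0 : ℝ) < v := hv
  positivity

lemma integral_log_quadForm_piGaussian {P : Matrix (Fin n) (Fin n) ℝ} (hsymm : Pᵀ = P)
    (hidem : P * P = P) {d : ℕ} (hd : P.trace = d) (hd0 : 0 < d) {m : Fin n → ℝ}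
    (hm : P *ᵥ m = 0) {v : ℝ≥0} (hv : 0 < v) :
    Integrable (fun y => Real.log (quadForm P y)) (piGaussian m v) ∧
    ∫ y, Real.log (quadForm P y) ∂(piGaussian m v) =
      Real.log v + (Real.log 2 + (Complex.digamma ((d : ℂ) / 2)).re) := by
  obtain ⟨K, hK, h⟩ := exists_identDistrib_quadForm_piGaussian hsymm hidem hd hm v
  have : Nontrivial K := Module.nontrivial_of_finrank_pos (R := ℝ) (hK ▸ hd0)
  have hlog := h.comp Real.measurable_log
  obtain ⟨h1, h2⟩ := integral_log_normSq_stdGaussian (E := K)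
  have hae : (fun x : K => Real.log v + Real.log (‖x‖ ^ 2)) =ᵐ[stdGaussian K]
      Real.log ∘ fun x : K => (v : ℝ) * ‖x‖ ^ 2 := by
    filter_upwards [ae_ne_zero_stdGaussian (E := K)] with x hx
    have : (0 : ℝ) < v := hv
    rw [Function.comp_apply, Real.log_mul this.ne' (by positivity)]
  refine ⟨hlog.integrable_iff.1 (((integrable_const _).add h1).congr hae), ?_⟩
  refine hlog.integral_eq.symm.trans ?_
  rw [← integral_congr_ae hae, integral_add (integrable_const _) h1, h2, hK]
  simp

lemma integral_inv_quadForm_piGaussian {P : Matrix (Fin n) (Fin n) ℝ} (hsymm : Pᵀ = P)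
    (hidem : P * P = P) {d : ℕ} (hd : P.trace = d) (hd2 : 2 < d) {m : Fin n → ℝ}
    (hm : P *ᵥ m = 0) (v : ℝ≥0) :
    Integrable (fun y => (quadForm P y)⁻¹) (piGaussian m v) ∧
    ∫ y, (quadForm P y)⁻¹ ∂(piGaussian m v) = (v : ℝ)⁻¹ * (1 / ((d : ℝ) - 2)) := by
  obtain ⟨K, hK, h⟩ := exists_identDistrib_quadForm_piGaussian hsymm hidem hd hm v
  have : Nontrivial K := Module.nontrivial_of_finrank_pos (R := ℝ) (by omega)
  have hinv := h.comp measurable_inv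
  obtain ⟨h1, h2⟩ := integral_inv_normSq_stdGaussian (E := K) (hK ▸ hd2)
  have he : (Inv.inv ∘ fun x : K => (v : ℝ) * ‖x‖ ^ 2) = fun x => (v : ℝ)⁻¹ * (‖x‖ ^ 2)⁻¹ := by
    ext x; simp [mul_comm]
  refine ⟨hinv.integrable_iff.1 (he ▸ h1.const_mul _), ?_⟩
  refine hinv.integral_eq.symm.trans ?_
  rw [he, integral_const_mul, h2, hK]

lemma not_integrable_inv_quadForm_piGaussian {P : Matrix (Fin n) (Fin n) ℝ} (hsymm : Pᵀ = P)
    (hidem : P * P = P) {d : ℕ} (hd : P.trace = d) (hd0 : 0 < d) (hd2 : d ≤ 2) {m : Fin n → ℝ}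
    (hm : P *ᵥ m = 0) {v : ℝ≥0} (hv : 0 < v) :
    ¬ Integrable (fun y => (quadForm P y)⁻¹) (piGaussian m v) := by
  obtain ⟨K, hK, h⟩ := exists_identDistrib_quadForm_piGaussian hsymm hidem hd hm v
  have : Nontrivial K := Module.nontrivial_of_finrank_pos (R := ℝ) (hK ▸ hd0)
  have hinv := h.comp measurable_inv
  have he : (Inv.inv ∘ fun x : K => (v : ℝ) * ‖x‖ ^ 2) = fun x => (v : ℝ)⁻¹ * (‖x‖ ^ 2)⁻¹ := by
    ext x; simp [mul_comm]
  have hv' : (v : ℝ)⁻¹ ≠ 0 := inv_ne_zero (NNReal.coe_pos.2 hv).ne'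
  intro hi
  have := hinv.integrable_iff.2 hi
  rw [he, integrable_const_mul_iff (IsUnit.mk0 _ hv')] at this
  exact not_integrable_inv_normSq_stdGaussian (hK ▸ hd2) this

end PiGaussian

/-! ### Integrals of multivariate normal kernels over the parameter space. -/

section GaussianKernel

variable {p : ℕ}

open scoped MatrixOrder in
lemma exists_isUnit_eq_transpose_mul_self {M : Matrix (Fin p) (Fin p) ℝ} (hM : M.PosDef) :
    ∃ B : Matrix (Fin p) (Fin p) ℝ, B.det ≠ 0 ∧ M = Bᵀ * B := by
  obtain ⟨B, hB, h⟩ := CStarAlgebra.isStrictlyPositive_iff_eq_star_mul_self.1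
    hM.isStrictlyPositive
  refine ⟨B, ((isUnit_iff_isUnit_det B).1 hB).ne_zero, ?_⟩
  rwa [star_eq_conjTranspose, conjTranspose_eq_transpose_of_trivial] at h

lemma quadForm_transpose_mul_self {n : ℕ} (B : Matrix (Fin n) (Fin p) ℝ) (t : Fin p → ℝ) :
    quadForm (Bᵀ * B) t = ∑ i, (B *ᵥ t) i ^ 2 := by
  rw [quadForm, ← mulVec_mulVec, dotProduct_mulVec, ← mulVec_transpose, transpose_transpose]
  simp [dotProduct, sq]

lemma integral_exp_neg_mul_sum_sq {w : ℝ} (hw : 0 < w) :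
    Integrable (fun u : Fin p → ℝ => Real.exp (-(w * ∑ i, u i ^ 2))) ∧
    ∫ u : Fin p → ℝ, Real.exp (-(w * ∑ i, u i ^ 2)) = (Real.pi / w) ^ ((p : ℝ) / 2) := by
  have hval : ∫ u : Fin p → ℝ, Real.exp (-(w * ∑ i, u i ^ 2)) =
      (Real.pi / w) ^ ((p : ℝ) / 2) := by
    have h := GaussianFourier.integral_rexp_neg_mul_sq_norm (V := EuclideanSpace ℝ (Fin p)) hw
    rw [← (PiLp.volume_preserving_toLp (Fin p)).integral_comp
      (MeasurableEquiv.toLp 2 _).measurableEmbedding] at h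
    simpa [EuclideanSpace.real_norm_sq_eq] using h
  refine ⟨?_, hval⟩
  -- A non-integrable function would have integral 0 by convention, against the positive value just
  -- found.
  by_contra hc
  rw [integral_undef hc] at hval
  have : 0 < (Real.pi / w) ^ ((p : ℝ) / 2) := by have := Real.pi_pos; positivity
  linarith

/-- Factoring `M = BᵀB` and substituting `u = B t` reduces a general normal kernel to the spherical
one. -/
lemma integral_comp_mulVec {F : Type*} [NormedAddCommGroup F] [NormedSpace ℝ F]
    {B : Matrix (Fin p) (Fin p) ℝ} (hB : B.det ≠ 0) {h : (Fin p → ℝ) → F} (hc : Continuous h)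
    (hi : Integrable h) :
    Integrable (fun t => h (B *ᵥ t)) ∧ ∫ t, h (B *ᵥ t) = |B.det⁻¹| • ∫ u, h u := by
  have hmap := Real.map_matrix_volume_pi_eq_smul_volume_pi hB
  have hmeas : Measurable (toLin' B) := (toLin' B).continuous_of_finiteDimensional.measurable
  constructor
  · have : Integrable h (Measure.map (toLin' B) volume) := by
      rw [hmap]; exact hi.smul_measure ENNReal.ofReal_ne_top
    exact this.comp_measurable hmeas
  · have := integral_map (μ := volume) hmeas.aemeasurable
      (hc.aestronglyMeasurable (μ := Measure.map (toLin' B) volume))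
    rw [hmap, integral_smul_measure, ENNReal.toReal_ofReal (abs_nonneg _)] at this
    simpa using this.symm

/-- The integral of an unnormalised multivariate normal density. -/
lemma integral_exp_neg_mul_quadForm {M : Matrix (Fin p) (Fin p) ℝ} (hM : M.PosDef) {w : ℝ}
    (hw : 0 < w) :
    Integrable (fun t : Fin p → ℝ => Real.exp (-(w * quadForm M t))) ∧
    ∫ t : Fin p → ℝ, Real.exp (-(w * quadForm M t)) =
      (Real.pi / w) ^ ((p : ℝ) / 2) / √M.det := by
  obtain ⟨B, hB, rfl⟩ := exists_isUnit_eq_transpose_mul_self hM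
  obtain ⟨h1, h2⟩ := integral_exp_neg_mul_sum_sq (p := p) hw
  obtain ⟨h3, h4⟩ := integral_comp_mulVec hB (by fun_prop) h1
  simp_rw [quadForm_transpose_mul_self]
  refine ⟨h3, h4.trans ?_⟩
  rw [h2, det_mul, det_transpose, Real.sqrt_mul_self_eq_abs, abs_inv, smul_eq_mul]
  ring

/-- The mean of a multivariate normal density exists. -/
lemma integrable_exp_neg_mul_quadForm_smul {M : Matrix (Fin p) (Fin p) ℝ} (hM : M.PosDef) {w : ℝ}
    (hw : 0 < w) :
    Integrable (fun t : Fin p → ℝ => Real.exp (-(w * quadForm M t)) • t) := by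
  obtain ⟨B, hB, rfl⟩ := exists_isUnit_eq_transpose_mul_self hM
  have key : Integrable (fun u : Fin p → ℝ => Real.exp (-(w * ∑ i, u i ^ 2)) • u) := by
    have h1 := (integral_exp_neg_mul_sum_sq (p := p) (half_pos hw)).1.const_mul (1 + 2 / w)
    refine h1.mono' (by fun_prop) (.of_forall fun u => ?_)
    set q := ∑ i, u i ^ 2 with hq
    have hq0 : 0 ≤ q := Finset.sum_nonneg fun i _ => sq_nonneg _
    have hu : ‖u‖ ≤ 1 + q := by
      refine (pi_norm_le_iff_of_nonneg (by linarith)).2 fun i => ?_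
      have h2 : u i ^ 2 ≤ q := Finset.single_le_sum (f := fun i => u i ^ 2)
        (fun i _ => sq_nonneg _) (Finset.mem_univ i)
      rw [Real.norm_eq_abs]
      nlinarith [sq_nonneg (|u i| - 1), sq_abs (u i)]
    -- Half of the exponent is spent on absorbing the factor `‖u‖`; the constant `1 + 2 / w` makes
    -- the bound `exp x ≥ x + 1` sufficient.
    have he : 1 + q ≤ (1 + 2 / w) * Real.exp (w / 2 * q) := by
      have h3 := Real.add_one_le_exp (w / 2 * q)
      calc 1 + q ≤ (1 + 2 / w) * (w / 2 * q + 1) := by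
            have : (1 + 2 / w) * (w / 2 * q + 1) = 1 + q + (w / 2 * q + 2 / w) := by
              field_simp; ring
            rw [this]
            have : 0 ≤ w / 2 * q + 2 / w := by positivity
            linarith
        _ ≤ _ := by gcongr
    rw [norm_smul, Real.norm_of_nonneg (Real.exp_pos _).le]
    calc Real.exp (-(w * q)) * ‖u‖
        ≤ Real.exp (-(w * q)) * ((1 + 2 / w) * Real.exp (w / 2 * q)) := by
          gcongr; exact hu.trans he
      _ = (1 + 2 / w) * (Real.exp (-(w * q)) * Real.exp (w / 2 * q)) := by ring
      _ = _ := by rw [← Real.exp_add]; ring_nf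
  have h2 := (integral_comp_mulVec hB (by fun_prop) key).1
  -- The substitution leaves `B *ᵥ t` as the vector factor; applying `B⁻¹` restores `t`.
  have h3 := (LinearMap.toContinuousLinearMap B⁻¹.mulVecLin).integrable_comp h2
  refine h3.congr (.of_forall fun t => ?_)
  simp only [LinearMap.coe_toContinuousLinearMap', mulVecLin_apply, mulVec_smul, mulVec_mulVec,
    nonsing_inv_mul B (isUnit_iff_ne_zero.2 hB), one_mulVec, quadForm_transpose_mul_self]

lemma quadForm_neg (M : Matrix (Fin p) (Fin p) ℝ) (t : Fin p → ℝ) :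
    quadForm M (-t) = quadForm M t := by
  simp [quadForm, mulVec_neg]

end GaussianKernel

/-! ### The Gibbs posterior of a quadratic loss under the uniform prior. -/

section QuadraticLoss

variable {p : ℕ} {M : Matrix (Fin p) (Fin p) ℝ} {loss : (Fin p → ℝ) → ℝ} {R w : ℝ}
  {m : Fin p → ℝ}

/-- The minimal loss `R` enters only through a factor free of `t`, which cancels on normalisation.
-/
lemma gibbsKernel_quadratic (hloss : ∀ s, loss s = R + quadForm M (s - m)) (t : Fin p → ℝ) :
    gibbsKernel w loss (fun _ => 1) t =
      Real.exp (-(w * R)) * Real.exp (-(w * quadForm M (t - m))) := by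
  rw [gibbsKernel, hloss, mul_one, ← Real.exp_add]
  ring_nf

lemma integral_gibbsKernel_quadratic (hM : M.PosDef)
    (hloss : ∀ s, loss s = R + quadForm M (s - m)) (hw : 0 < w) :
    Integrable (gibbsKernel w loss (fun _ => 1)) ∧
    ∫ t, gibbsKernel w loss (fun _ => 1) t =
      Real.exp (-(w * R)) * ((Real.pi / w) ^ ((p : ℝ) / 2) / √M.det) := by
  obtain ⟨h1, h2⟩ := integral_exp_neg_mul_quadForm hM hw
  rw [funext (gibbsKernel_quadratic (w := w) hloss)]
  refine ⟨(h1.comp_sub_right m).const_mul _, ?_⟩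
  rw [integral_const_mul, integral_sub_right_eq_self
    (fun t => Real.exp (-(w * quadForm M t))) m, h2]

/-- Under a positive definite quadratic loss and the uniform prior, the Gibbs posterior exists if
and only if the calibration weight is positive. -/
lemma gibbsPosteriorExists_quadratic (hM : M.PosDef)
    (hloss : ∀ s, loss s = R + quadForm M (s - m)) :
    GibbsPosteriorExists w loss (fun _ => 1) ↔ 0 < w := by
  refine ⟨fun h => h.1, fun hw => ?_⟩
  obtain ⟨h1, h2⟩ := integral_gibbsKernel_quadratic hM hloss hw
  have hpos : ∀ t, 0 ≤ gibbsKernel w loss (fun _ => 1) t := fun t => by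
    rw [gibbsKernel, mul_one]; positivity
  have h := ofReal_integral_eq_lintegral_ofReal h1 (.of_forall hpos)
  refine ⟨hw, ?_, ?_⟩
  · rw [← h, h2]
    have hdet := hM.det_pos
    have := Real.pi_pos
    simp only [ne_eq, ENNReal.ofReal_eq_zero, not_le]
    positivity
  · rw [← h]; exact ENNReal.ofReal_ne_top

lemma gibbsPdf_quadratic (hM : M.PosDef) (hloss : ∀ s, loss s = R + quadForm M (s - m))
    (hw : 0 < w) (t : Fin p → ℝ) :
    gibbsPdf w loss (fun _ => 1) t =
      Real.exp (-(w * quadForm M (t - m))) / ((Real.pi / w) ^ ((p : ℝ) / 2) / √M.det) := by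
  rw [gibbsPdf, (integral_gibbsKernel_quadratic hM hloss hw).2, gibbsKernel_quadratic hloss,
    mul_div_mul_left _ _ (Real.exp_pos _).ne']

lemma log_gibbsPdf_quadratic (hM : M.PosDef) (hloss : ∀ s, loss s = R + quadForm M (s - m))
    (hw : 0 < w) (t : Fin p → ℝ) :
    Real.log (gibbsPdf w loss (fun _ => 1) t) =
      -(w * quadForm M (t - m)) - (p : ℝ) / 2 * Real.log (Real.pi / w)
        + 1 / 2 * Real.log M.det := by
  have hdet := hM.det_pos
  have := Real.pi_pos
  rw [gibbsPdf_quadratic hM hloss hw, Real.log_div (by positivity) (by positivity), Real.log_exp,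
    Real.log_div (by positivity) (by positivity), Real.log_rpow (by positivity),
    Real.log_sqrt hdet.le]
  ring

lemma gibbsMean_quadratic (hM : M.PosDef) (hloss : ∀ s, loss s = R + quadForm M (s - m))
    (hw : 0 < w) : gibbsMean w loss (fun _ => 1) = m := by
  obtain ⟨h1, h2⟩ := integral_exp_neg_mul_quadForm hM hw
  have h3 := integrable_exp_neg_mul_quadForm_smul hM hw
  set c := (Real.pi / w) ^ ((p : ℝ) / 2) / √M.det with hc
  have hc0 : 0 < c := by
    have hdet := hM.det_pos
    have := Real.pi_pos
    positivity
  have hpdf := gibbsPdf_quadratic hM hloss hw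
  have hmeas : Measurable (gibbsPdf w loss (fun _ => 1)) := by
    rw [funext hpdf]; fun_prop
  -- The kernel is even, so this integral equals its own negative.
  have hodd : ∫ t : Fin p → ℝ, Real.exp (-(w * quadForm M t)) • t = 0 := by
    have h := integral_neg_eq_self (fun t : Fin p → ℝ => Real.exp (-(w * quadForm M t)) • t) volume
    simp only [quadForm_neg, smul_neg, integral_neg] at h
    exact self_eq_neg.1 h.symm
  rw [gibbsMean, gibbsPosterior, integral_withDensity_eq_integral_toReal_smul
    (by fun_prop) (by simp)]
  have e1 : ∀ t : Fin p → ℝ, (ENNReal.ofReal (gibbsPdf w loss (fun _ => 1) t)).toReal • t =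
      c⁻¹ • (fun s => Real.exp (-(w * quadForm M s)) • s + Real.exp (-(w * quadForm M s)) • m)
        (t - m) := fun t => by
    rw [hpdf, ENNReal.toReal_ofReal (by positivity)]
    simp only
    rw [← smul_add, sub_add_cancel, smul_smul, div_eq_inv_mul]
  simp_rw [e1]
  rw [integral_smul, integral_sub_right_eq_self
    (fun s => Real.exp (-(w * quadForm M s)) • s + Real.exp (-(w * quadForm M s)) • m) m,
    integral_add h3 (h1.smul_const m), hodd, integral_smul_const, h2, zero_add, smul_smul,
    inv_mul_cancel₀ hc0.ne', one_smul]

end QuadraticLoss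

/-! ### Hat matrices of full-rank models. -/

section Hat

variable {ι : Type*} [Fintype ι] [DecidableEq ι] {n : ℕ} {Z : Matrix (Fin n) ι ℝ}

lemma hat_mul_self (hZ : (Zᵀ * Z).det ≠ 0) : Z * (Zᵀ * Z)⁻¹ * Zᵀ * Z = Z := by
  rw [Matrix.mul_assoc, Matrix.mul_assoc, nonsing_inv_mul _ (isUnit_iff_ne_zero.2 hZ),
    Matrix.mul_one]

lemma hat_transpose (Z : Matrix (Fin n) ι ℝ) :
    (Z * (Zᵀ * Z)⁻¹ * Zᵀ)ᵀ = Z * (Zᵀ * Z)⁻¹ * Zᵀ := by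
  simp only [transpose_mul, transpose_nonsing_inv, transpose_transpose, Matrix.mul_assoc]

lemma hat_idem (hZ : (Zᵀ * Z).det ≠ 0) :
    (Z * (Zᵀ * Z)⁻¹ * Zᵀ) * (Z * (Zᵀ * Z)⁻¹ * Zᵀ) = Z * (Zᵀ * Z)⁻¹ * Zᵀ := by
  rw [← Matrix.mul_assoc, ← Matrix.mul_assoc, hat_mul_self hZ]

lemma trace_hat (hZ : (Zᵀ * Z).det ≠ 0) :
    (Z * (Zᵀ * Z)⁻¹ * Zᵀ).trace = Fintype.card ι := by
  rw [Matrix.mul_assoc, trace_mul_comm, Matrix.mul_assoc,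
    nonsing_inv_mul _ (isUnit_iff_ne_zero.2 hZ), trace_one]

end Hat

/-! ### The unique-treatment model and its pure-error projection. -/

section Design

variable {𝕏 : Type*} {n p : ℕ} (X : Fin n → 𝕏)

/-- `ZᵀZ` is diagonal with the replication counts as entries; each is positive because columns are
indexed by treatments that occur. -/
lemma treatmentMatrix_gram_det_ne_zero [Fintype (Set.range X)] [DecidableEq (Set.range X)] :
    ((treatmentMatrix X)ᵀ * treatmentMatrix X).det ≠ 0 := by
  classical
  have : (treatmentMatrix X)ᵀ * treatmentMatrix X =
      diagonal fun j : Set.range X => ∑ i, if X i = j then (1 : ℝ) else 0 := by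
    ext j k
    simp only [mul_apply, transpose_apply, treatmentMatrix, of_apply, diagonal_apply]
    split_ifs with h
    · subst h
      exact Finset.sum_congr rfl fun i _ => by split_ifs <;> simp
    · refine Finset.sum_eq_zero fun i _ => ?_
      split_ifs with h1 h2
      · exact absurd (Subtype.ext (h1.symm.trans h2)) h
      all_goals simp
  rw [this, det_diagonal, Finset.prod_ne_zero_iff]
  rintro ⟨_, i, rfl⟩ _
  refine (Finset.sum_pos' (fun k _ => by split_ifs <;> simp) ⟨i, Finset.mem_univ _, ?_⟩).ne'
  simp

lemma treatmentHat_transpose : (treatmentHat X)ᵀ = treatmentHat X := by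
  classical exact hat_transpose _

lemma treatmentHat_idem : treatmentHat X * treatmentHat X = treatmentHat X := by
  classical exact hat_idem (treatmentMatrix_gram_det_ne_zero X)

lemma trace_treatmentHat : (treatmentHat X).trace = numTreatments X := by
  classical
  rw [numTreatments, Set.ncard_eq_toFinset_card', Set.toFinset_card]
  exact trace_hat (treatmentMatrix_gram_det_ne_zero X)

/-- A vector depending on the treatment alone lies in the column space of `Z`. This applies to the
mean vector and to each column of `F`. -/
lemma treatmentHat_mulVec (g : 𝕏 → ℝ) :
    treatmentHat X *ᵥ (fun i => g (X i)) = fun i => g (X i) := by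
  classical
  have h : (fun i => g (X i)) = treatmentMatrix X *ᵥ fun j : Set.range X => g j := by
    ext i
    simp only [mulVec, dotProduct, treatmentMatrix, of_apply]
    rw [Finset.sum_eq_single ⟨X i, i, rfl⟩]
    · simp
    · rintro j _ hj
      rw [if_neg fun h => hj (Subtype.ext h.symm), zero_mul]
    · simp
  rw [h, mulVec_mulVec]
  congr 1
  exact hat_mul_self (treatmentMatrix_gram_det_ne_zero X)

lemma numTreatments_le : numTreatments X ≤ n := by
  rw [numTreatments, ← Set.image_univ]
  refine (Set.ncard_image_le).trans ?_
  simp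

lemma numTreatments_pos (hn : 0 < n) : 0 < numTreatments X := by
  rw [numTreatments, Set.ncard_pos]
  exact ⟨X ⟨0, hn⟩, ⟨0, hn⟩, rfl⟩

/-- The projection on the orthogonal complement of the unique-treatment model. -/
noncomputable def pureErrorProj : Matrix (Fin n) (Fin n) ℝ := 1 - treatmentHat X

lemma pureErrorProj_transpose : (pureErrorProj X)ᵀ = pureErrorProj X := by
  rw [pureErrorProj, transpose_sub, transpose_one, treatmentHat_transpose]

lemma pureErrorProj_mul_treatmentHat : pureErrorProj X * treatmentHat X = 0 := by
  rw [pureErrorProj, Matrix.sub_mul, Matrix.one_mul, treatmentHat_idem, sub_self]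

lemma pureErrorProj_idem : pureErrorProj X * pureErrorProj X = pureErrorProj X := by
  nth_rw 2 [pureErrorProj]
  rw [Matrix.mul_sub, pureErrorProj_mul_treatmentHat, Matrix.mul_one, sub_zero]

lemma trace_pureErrorProj : (pureErrorProj X).trace = pureErrorDF X := by
  rw [pureErrorProj, trace_sub, trace_one, trace_treatmentHat, pureErrorDF,
    Nat.cast_sub (numTreatments_le X), Fintype.card_fin]

lemma pureErrorProj_mulVec (g : 𝕏 → ℝ) : pureErrorProj X *ᵥ (fun i => g (X i)) = 0 := by
  rw [pureErrorProj, sub_mulVec, treatmentHat_mulVec, one_mulVec, sub_self]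

lemma pureErrorProj_mul_modelMatrix (f : 𝕏 → Fin p → ℝ) :
    pureErrorProj X * modelMatrix f X = 0 := by
  ext i j
  exact congrFun (pureErrorProj_mulVec X fun x => f x j) i

lemma quadForm_sum_sq {P : Matrix (Fin n) (Fin n) ℝ} (hsymm : Pᵀ = P) (hidem : P * P = P)
    (y : Fin n → ℝ) : quadForm P y = ∑ i, (P *ᵥ y) i ^ 2 := by
  rw [← quadForm_transpose_mul_self, hsymm, hidem]

/-- Division by zero gives 0 on both sides, so no case distinction is needed for `d = 0` or a
vanishing quadratic form. -/
lemma calibWeight_eq (y : Fin n → ℝ) :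
    calibWeight X y = (pureErrorDF X : ℝ) / 2 * (quadForm (pureErrorProj X) y)⁻¹ := by
  rw [calibWeight, pureErrorVar, pureErrorProj, one_div, mul_inv, mul_inv, one_div, inv_inv]
  ring

lemma quadForm_pureErrorProj_nonneg (y : Fin n → ℝ) : 0 ≤ quadForm (pureErrorProj X) y := by
  rw [quadForm_sum_sq (pureErrorProj_transpose X) (pureErrorProj_idem X)]
  positivity

lemma calibWeight_nonneg (y : Fin n → ℝ) : 0 ≤ calibWeight X y := by
  rw [calibWeight_eq]
  have := quadForm_pureErrorProj_nonneg X y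
  positivity

lemma measurable_calibWeight : Measurable (calibWeight X) := by
  rw [funext (calibWeight_eq X)]
  have := continuous_quadForm (pureErrorProj X)
  fun_prop

end Design

/-! ### Decompositions of the sum of squares. -/

section Loss

variable {𝕏 : Type*} {n p : ℕ} (f : 𝕏 → Fin p → ℝ) (X : Fin n → 𝕏)

/-- The coefficient matrix of the least squares estimator. -/
noncomputable def lsMatrix : Matrix (Fin p) (Fin n) ℝ :=
  ((modelMatrix f X)ᵀ * modelMatrix f X)⁻¹ * (modelMatrix f X)ᵀ

lemma lsMatrix_mulVec (y : Fin n → ℝ) :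
    lsMatrix f X *ᵥ y =
      ((modelMatrix f X)ᵀ * modelMatrix f X)⁻¹ *ᵥ ((modelMatrix f X)ᵀ *ᵥ y) := by
  rw [lsMatrix, mulVec_mulVec]

lemma ssLoss_eq_sum (t : Fin p → ℝ) (y : Fin n → ℝ) :
    ssLoss f X t y = ∑ i, (y - modelMatrix f X *ᵥ t) i ^ 2 := rfl

lemma ssLoss_eq_quadForm_one (t : Fin p → ℝ) (y : Fin n → ℝ) :
    ssLoss f X t y = quadForm 1 (y - modelMatrix f X *ᵥ t) := by
  rw [ssLoss_eq_sum, quadForm, one_mulVec]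
  simp [dotProduct, sq]

lemma ssLoss_nonneg (t : Fin p → ℝ) (y : Fin n → ℝ) : 0 ≤ ssLoss f X t y := by
  rw [ssLoss]; positivity

/-- The sum of squares splits into pure error and the distance between the unique-treatment fit
and the model. -/
lemma ssLoss_eq_pureError_add (t : Fin p → ℝ) (y : Fin n → ℝ) :
    ssLoss f X t y = quadForm (pureErrorProj X) y +
      quadForm (treatmentHat X) (y - modelMatrix f X *ᵥ t) := by
  have h0 : pureErrorProj X *ᵥ (-(modelMatrix f X *ᵥ t)) = 0 := by
    rw [mulVec_neg, mulVec_mulVec, pureErrorProj_mul_modelMatrix, zero_mulVec, neg_zero]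
  have h := quadForm_add_smul (pureErrorProj_transpose X) h0 1 y
  rw [one_smul, one_pow, one_mul, neg_add_eq_sub] at h
  rw [ssLoss_eq_quadForm_one, ← h, pureErrorProj, quadForm, quadForm, quadForm, sub_mulVec,
    dotProduct_sub, sub_add_cancel]

variable {f X}

lemma posDef_gram (hdet : ((modelMatrix f X)ᵀ * modelMatrix f X).det ≠ 0) :
    ((modelMatrix f X)ᵀ * modelMatrix f X).PosDef := by
  have h := posSemidef_conjTranspose_mul_self (modelMatrix f X)
  rw [conjTranspose_eq_transpose_of_trivial] at h
  exact h.posDef_iff_det_ne_zero.2 hdet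

/-- The sum of squares is minimal at the least squares estimate. -/
lemma ssLoss_eq_min_add (hdet : ((modelMatrix f X)ᵀ * modelMatrix f X).det ≠ 0)
    (t : Fin p → ℝ) (y : Fin n → ℝ) :
    ssLoss f X t y = ssLoss f X (lsMatrix f X *ᵥ y) y +
      quadForm ((modelMatrix f X)ᵀ * modelMatrix f X) (t - lsMatrix f X *ᵥ y) := by
  set F := modelMatrix f X with hF
  set m := lsMatrix f X *ᵥ y with hm
  -- The normal equations: the residual is orthogonal to the columns of `F`.
  have h0 : Fᵀ *ᵥ (y - F *ᵥ m) = 0 := by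
    rw [mulVec_sub, mulVec_mulVec, hm, lsMatrix, mulVec_mulVec, ← Matrix.mul_assoc,
      mul_nonsing_inv _ (isUnit_iff_ne_zero.2 hdet), Matrix.one_mul, sub_self]
  have hsplit : y - F *ᵥ t = (y - F *ᵥ m) - F *ᵥ (t - m) := by
    rw [mulVec_sub]; abel
  have hcross : (y - F *ᵥ m) ⬝ᵥ (F *ᵥ (t - m)) = 0 := by
    rw [dotProduct_mulVec, ← mulVec_transpose, h0, zero_dotProduct]
  rw [ssLoss_eq_quadForm_one, ssLoss_eq_quadForm_one, quadForm_transpose_mul_self, ← hF, hsplit]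
  set a := y - F *ᵥ m
  set b := F *ᵥ (t - m)
  have hb : ∑ i, b i ^ 2 = b ⬝ᵥ b := by simp [dotProduct, sq]
  rw [hb]
  simp only [quadForm, one_mulVec, sub_dotProduct, dotProduct_sub]
  rw [dotProduct_comm b a, hcross]
  ring

/-- This orthogonality makes the calibration weight independent of the least squares estimate. -/
lemma pureErrorProj_mul_lsMatrix_transpose : pureErrorProj X * (lsMatrix f X)ᵀ = 0 := by
  rw [lsMatrix, transpose_mul, transpose_transpose, ← Matrix.mul_assoc,
    pureErrorProj_mul_modelMatrix, Matrix.zero_mul]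

/-- Distances between estimate and target become quadratic forms in the centred responses, to which
the mean formula applies. -/
lemma quadForm_lsMatrix (V : Matrix (Fin p) (Fin p) ℝ) (y c : Fin n → ℝ) :
    quadForm V (lsMatrix f X *ᵥ c - lsMatrix f X *ᵥ y) =
      quadForm ((lsMatrix f X)ᵀ * V * lsMatrix f X) (y - c) := by
  rw [← mulVec_sub, ← neg_sub y c, mulVec_neg, quadForm_neg, quadForm, quadForm,
    ← mulVec_mulVec, ← mulVec_mulVec, dotProduct_mulVec (y - c), ← mulVec_transpose,
    transpose_transpose]

lemma lsMatrix_mul_transpose (hdet : ((modelMatrix f X)ᵀ * modelMatrix f X).det ≠ 0) :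
    lsMatrix f X * (lsMatrix f X)ᵀ = ((modelMatrix f X)ᵀ * modelMatrix f X)⁻¹ := by
  rw [lsMatrix, transpose_mul, transpose_transpose, transpose_nonsing_inv, transpose_mul,
    transpose_transpose, Matrix.mul_assoc, ← Matrix.mul_assoc _ (modelMatrix f X),
    mul_nonsing_inv _ (isUnit_iff_ne_zero.2 hdet), Matrix.mul_one]

lemma trace_lsMatrix_one (hdet : ((modelMatrix f X)ᵀ * modelMatrix f X).det ≠ 0) :
    ((lsMatrix f X)ᵀ * (1 : Matrix (Fin p) (Fin p) ℝ) * lsMatrix f X).trace =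
      (((modelMatrix f X)ᵀ * modelMatrix f X)⁻¹).trace := by
  rw [Matrix.mul_one, trace_mul_comm, lsMatrix_mul_transpose hdet]

lemma trace_lsMatrix_gram (hdet : ((modelMatrix f X)ᵀ * modelMatrix f X).det ≠ 0) :
    ((lsMatrix f X)ᵀ * ((modelMatrix f X)ᵀ * modelMatrix f X) * lsMatrix f X).trace = p := by
  rw [trace_mul_comm, ← Matrix.mul_assoc, lsMatrix_mul_transpose hdet,
    nonsing_inv_mul _ (isUnit_iff_ne_zero.2 hdet), trace_one, Fintype.card_fin]

lemma pos_of_gram_det_ne_zero (hp : 0 < p)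
    (hdet : ((modelMatrix f X)ᵀ * modelMatrix f X).det ≠ 0) : 0 < n := by
  rcases Nat.eq_zero_or_pos n with rfl | h
  · exfalso
    have : Nonempty (Fin p) := ⟨⟨0, hp⟩⟩
    refine hdet ?_
    rw [show (modelMatrix f X)ᵀ * modelMatrix f X = 0 by ext i j; simp [mul_apply], det_zero]
  · exact h

end Loss

/-! ### Expectations with values in the extended reals. -/

section Expectation

variable {Ω : Type*} [MeasurableSpace Ω] {P : Measure Ω} {g : Ω → EReal}

lemma HasExpectation.congr_ae {g' : Ω → EReal} {a : EReal} (h : HasExpectation P g a)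
    (hg : g =ᵐ[P] g') : HasExpectation P g' a := by
  obtain ⟨h1, h2, h3⟩ := h
  have e1 : ∫⁻ x, (g x).toENNReal ∂P = ∫⁻ x, (g' x).toENNReal ∂P :=
    lintegral_congr_ae (hg.fun_comp EReal.toENNReal)
  have e2 : ∫⁻ x, (-g x).toENNReal ∂P = ∫⁻ x, (-g' x).toENNReal ∂P :=
    lintegral_congr_ae (hg.fun_comp fun z => (-z).toENNReal)
  rw [e1, e2] at h2 h3
  exact ⟨h1.congr hg, h2, h3⟩

lemma neg_coe_toENNReal (x : ℝ) : (-(x : EReal)).toENNReal = ENNReal.ofReal (-x) := by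
  rw [← EReal.coe_neg, EReal.real_coe_toENNReal]

lemma hasExpectation_coe {f : Ω → ℝ} (hf : Integrable f P) :
    HasExpectation P (fun x => (f x : EReal)) ((∫ x, f x ∂P : ℝ) : EReal) := by
  have h1 : ∫⁻ x, ENNReal.ofReal (f x) ∂P ≠ ⊤ := hf.lintegral_lt_top.ne
  have h2 : ∫⁻ x, ENNReal.ofReal (-f x) ∂P ≠ ⊤ := hf.neg.lintegral_lt_top.ne
  refine ⟨measurable_coe_real_ereal.comp_aemeasurable hf.aemeasurable, ?_, ?_⟩
  · simp only [EReal.real_coe_toENNReal]; exact Or.inl h1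
  · simp only [EReal.real_coe_toENNReal, neg_coe_toENNReal]
    rw [integral_eq_lintegral_pos_part_sub_lintegral_neg_part hf, EReal.coe_sub,
      EReal.coe_ennreal_toReal h1, EReal.coe_ennreal_toReal h2]

lemma hasExpectation_bot [IsProbabilityMeasure P] : HasExpectation P (fun _ => ⊥) ⊥ := by
  refine ⟨aemeasurable_const, ?_, ?_⟩ <;> simp

/-- A variable with integrable upper bound and non-integrable negative part has mean `-∞`. -/
lemma hasExpectation_bot_of_sub {a b : Ω → ℝ} (ha : Integrable a P) (hb : AEMeasurable b P)
    (hb0 : ∀ x, 0 ≤ b x) (htop : ∫⁻ x, ENNReal.ofReal (b x) ∂P = ⊤) :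
    HasExpectation P (fun x => ((a x - b x : ℝ) : EReal)) ⊥ := by
  have h1 : ∫⁻ x, ENNReal.ofReal (a x) ∂P ≠ ⊤ := ha.lintegral_lt_top.ne
  have h2 : ∫⁻ x, ENNReal.ofReal (a x - b x) ∂P ≠ ⊤ :=
    ne_top_of_le_ne_top h1 (lintegral_mono fun x =>
      ENNReal.ofReal_le_ofReal (by linarith [hb0 x]))
  have h3 : ∫⁻ x, ENNReal.ofReal (-(a x - b x)) ∂P = ⊤ := by
    -- Pointwise `b ≤ (a - b)⁻ + a⁺`, and `a⁺` has finite integral.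
    have hle : ∫⁻ x, ENNReal.ofReal (b x) ∂P ≤
        ∫⁻ x, ENNReal.ofReal (-(a x - b x)) ∂P + ∫⁻ x, ENNReal.ofReal (a x) ∂P := by
      rw [← lintegral_add_right' _ ha.aemeasurable.ennreal_ofReal]
      refine lintegral_mono fun x => ?_
      refine le_trans (le_of_eq ?_) ENNReal.ofReal_add_le
      congr 1; ring
    rw [htop, top_le_iff, ENNReal.add_eq_top] at hle
    exact hle.resolve_right h1
  refine ⟨measurable_coe_real_ereal.comp_aemeasurable (ha.aemeasurable.sub hb), ?_, ?_⟩
  · simp only [EReal.real_coe_toENNReal]; exact Or.inl h2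
  · simp only [EReal.real_coe_toENNReal, neg_coe_toENNReal]
    rw [h3, ← EReal.coe_ennreal_toReal h2]
    rfl

end Expectation

/-! ### Expected losses and their minimisers. -/

section Target

variable {n p : ℕ}

/-- The minimiser of an expected loss which is a positive definite quadratic function. -/
lemma isTarget_iff_of_quadratic {D : Measure (Fin n → ℝ)} {w : (Fin n → ℝ) → ℝ}
    {loss : (Fin p → ℝ) → (Fin n → ℝ) → ℝ} {M : Matrix (Fin p) (Fin p) ℝ} (hM : M.PosDef)
    {A W : ℝ≥0∞} {c : ℝ} {t₀ : Fin p → ℝ} (hA : A ≠ ⊤) (hW : W ≠ ⊤) (hW0 : W ≠ 0) (hc : 0 ≤ c)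
    (h : ∀ t, ∫⁻ y, ENNReal.ofReal (w y * loss t y) ∂D =
      A + W * ENNReal.ofReal (c + quadForm M (t - t₀))) (t : Fin p → ℝ) :
    IsTarget D w loss t ↔ t = t₀ := by
  have hq : ∀ u, u ≠ 0 → 0 < quadForm M u := fun u hu => by
    simpa [quadForm] using hM.dotProduct_mulVec_pos hu
  have hq0 : quadForm M 0 = 0 := by simp [quadForm]
  simp only [IsTarget, h]
  constructor
  · rintro ⟨-, hmin⟩
    by_contra hne
    have h1 := hmin t₀
    rw [sub_self, hq0, add_zero] at h1
    -- Cancelling `A` and `W` is legitimate only because `A` is finite and `W` is neither 0 nor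
    -- infinite.
    have h2 := (ENNReal.mul_le_mul_iff_right hW0 hW).1 ((ENNReal.add_le_add_iff_left hA).1 h1)
    rw [ENNReal.ofReal_le_ofReal_iff hc] at h2
    linarith [hq _ (sub_ne_zero.2 hne)]
  · rintro rfl
    refine ⟨ENNReal.add_ne_top.2 ⟨hA, ENNReal.mul_ne_top hW ENNReal.ofReal_ne_top⟩, fun s => ?_⟩
    gcongr
    rw [sub_self, hq0]
    rcases eq_or_ne (s - t) 0 with h0 | h0
    · rw [h0, hq0]
    · exact (hq _ h0).le

variable {𝕏 : Type*} {X : Fin n → 𝕏} {f : 𝕏 → Fin p → ℝ} {μ : 𝕏 → ℝ} {v : ℝ≥0}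

lemma ae_pureError_pos (hd : 0 < pureErrorDF X) (hv : 0 < v) :
    ∀ᵐ y ∂(piGaussian (fun i => μ (X i)) v), 0 < quadForm (pureErrorProj X) y :=
  ae_quadForm_pos_piGaussian (pureErrorProj_transpose X) (pureErrorProj_idem X)
    (trace_pureErrorProj X) hd (pureErrorProj_mulVec X μ) hv

lemma lintegral_calibWeight_eq_top (hd : 0 < pureErrorDF X) (hd2 : pureErrorDF X ≤ 2)
    (hv : 0 < v) :
    ∫⁻ y, ENNReal.ofReal (calibWeight X y) ∂(piGaussian (fun i => μ (X i)) v) = ⊤ := by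
  by_contra hne
  refine not_integrable_inv_quadForm_piGaussian (pureErrorProj_transpose X) (pureErrorProj_idem X)
    (trace_pureErrorProj X) hd hd2 (pureErrorProj_mulVec X μ) hv ?_
  have hi : Integrable (calibWeight X) (piGaussian (fun i => μ (X i)) v) :=
    (lintegral_ofReal_ne_top_iff_integrable (measurable_calibWeight X).aestronglyMeasurable
      (.of_forall (calibWeight_nonneg X))).1 hne
  rw [funext (calibWeight_eq X)] at hi
  exact (integrable_const_mul_iff (IsUnit.mk0 _ (by positivity)) _).1 hi

lemma lintegral_calibWeight (hd : 2 < pureErrorDF X) :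
    ∫⁻ y, ENNReal.ofReal (calibWeight X y) ∂(piGaussian (fun i => μ (X i)) v) =
      ENNReal.ofReal ((pureErrorDF X : ℝ) / 2 * ((v : ℝ)⁻¹ * (1 / ((pureErrorDF X : ℝ) - 2)))) := by
  obtain ⟨h1, h2⟩ := integral_inv_quadForm_piGaussian (pureErrorProj_transpose X)
    (pureErrorProj_idem X) (trace_pureErrorProj X) hd (pureErrorProj_mulVec X μ) v
  rw [← h2, ← integral_const_mul, ofReal_integral_eq_lintegral_ofReal (h1.const_mul _)]
  · simp_rw [calibWeight_eq]
  · exact .of_forall fun y => by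
      simpa only [calibWeight_eq, Pi.zero_apply] using calibWeight_nonneg X y

/-- The calibration weight is independent of the unique-treatment fit. -/
lemma lintegral_calibWeight_mul {k : ℕ} {B : Matrix (Fin k) (Fin n) ℝ}
    (hB : pureErrorProj X * Bᵀ = 0) (m : Fin n → ℝ) {g : (Fin k → ℝ) → ℝ} (hg : Measurable g) :
    ∫⁻ y, ENNReal.ofReal (calibWeight X y * g (B *ᵥ y)) ∂(piGaussian m v) =
      (∫⁻ y, ENNReal.ofReal (calibWeight X y) ∂(piGaussian m v)) *
        ∫⁻ y, ENNReal.ofReal (g (B *ᵥ y)) ∂(piGaussian m v) := by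
  have hind := indepFun_mulVec_piGaussian m v (pureErrorProj X) B hB
  have e : ∀ y, calibWeight X y =
      (fun u : Fin n → ℝ => (pureErrorDF X : ℝ) / 2 * (∑ i, u i ^ 2)⁻¹) (pureErrorProj X *ᵥ y) :=
    fun y => by
      rw [calibWeight_eq, quadForm_sum_sq (pureErrorProj_transpose X) (pureErrorProj_idem X)]
  have hind' := hind.comp
    (φ := fun u : Fin n → ℝ => ENNReal.ofReal ((pureErrorDF X : ℝ) / 2 * (∑ i, u i ^ 2)⁻¹))
    (ψ := fun u => ENNReal.ofReal (g u)) (by fun_prop) (by fun_prop)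
  have hm := measurable_calibWeight X
  have hBm : Measurable fun y : Fin n → ℝ => B *ᵥ y :=
    (show Continuous fun y : Fin n → ℝ => B *ᵥ y by fun_prop).measurable
  rw [← lintegral_mul_eq_lintegral_mul_lintegral_of_indepFun (by fun_prop) (by fun_prop)]
  · refine lintegral_congr fun y => ?_
    rw [Pi.mul_apply, ENNReal.ofReal_mul (calibWeight_nonneg X y)]
  · simpa only [Function.comp_def, ← e] using hind'

lemma lintegral_quadForm_piGaussian {V : Matrix (Fin n) (Fin n) ℝ} (m c : Fin n → ℝ)
    (hV : ∀ u, 0 ≤ quadForm V u) :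
    ∫⁻ y, ENNReal.ofReal (quadForm V (y - c)) ∂(piGaussian m v) =
      ENNReal.ofReal (v * V.trace + quadForm V (m - c)) := by
  obtain ⟨h1, h2⟩ := integral_quadForm_piGaussian m c v V
  rw [← h2, ofReal_integral_eq_lintegral_ofReal h1 (.of_forall fun y => hV _)]

lemma lintegral_ssLoss (t : Fin p → ℝ) (m : Fin n → ℝ) :
    ∫⁻ y, ENNReal.ofReal (1 * ssLoss f X t y) ∂(piGaussian m v) =
      ENNReal.ofReal (v * n + ssLoss f X t m) := by
  simp_rw [one_mul, ssLoss_eq_quadForm_one]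
  rw [lintegral_quadForm_piGaussian, trace_one, Fintype.card_fin]
  intro u
  rw [quadForm, one_mulVec]
  simp only [dotProduct]
  exact Finset.sum_nonneg fun i _ => mul_self_nonneg _

/-- The expected weighted loss. -/
lemma lintegral_calibWeight_mul_ssLoss (hd : 0 < pureErrorDF X) (hv : 0 < v) (t : Fin p → ℝ) :
    ∫⁻ y, ENNReal.ofReal (calibWeight X y * ssLoss f X t y) ∂(piGaussian (fun i => μ (X i)) v) =
      ENNReal.ofReal ((pureErrorDF X : ℝ) / 2) +
      (∫⁻ y, ENNReal.ofReal (calibWeight X y) ∂(piGaussian (fun i => μ (X i)) v)) *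
        ENNReal.ofReal (v * numTreatments X + ssLoss f X t (fun i => μ (X i))) := by
  have hH : ∀ u, 0 ≤ quadForm (treatmentHat X) u := fun u => by
    rw [quadForm_sum_sq (treatmentHat_transpose X) (treatmentHat_idem X)]; positivity
  have hloss : ssLoss f X t (fun i => μ (X i)) =
      quadForm (treatmentHat X) ((fun i => μ (X i)) - modelMatrix f X *ᵥ t) := by
    rw [ssLoss_eq_pureError_add, quadForm, pureErrorProj_mulVec, dotProduct_zero, zero_add]
  have hfun : ∀ y, quadForm (treatmentHat X) (y - modelMatrix f X *ᵥ t) =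
      (fun u => ∑ i, (u - treatmentHat X *ᵥ (modelMatrix f X *ᵥ t)) i ^ 2)
        (treatmentHat X *ᵥ y) := fun y => by
    simp only
    rw [quadForm_sum_sq (treatmentHat_transpose X) (treatmentHat_idem X), mulVec_sub]
  have hPH : pureErrorProj X * (treatmentHat X)ᵀ = 0 := by
    rw [treatmentHat_transpose, pureErrorProj_mul_treatmentHat]
  -- Weight times pure error is almost surely the constant `d/2`; only the treatment part of the
  -- loss depends on `t`. Working with `∫⁻` keeps the identity valid when the mean weight is
  -- infinite.
  have h1 : ∫⁻ y, ENNReal.ofReal (calibWeight X y * ssLoss f X t y)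
        ∂(piGaussian (fun i => μ (X i)) v) =
      ∫⁻ y, (ENNReal.ofReal ((pureErrorDF X : ℝ) / 2) + ENNReal.ofReal (calibWeight X y *
        quadForm (treatmentHat X) (y - modelMatrix f X *ᵥ t)))
        ∂(piGaussian (fun i => μ (X i)) v) := by
    refine lintegral_congr_ae ?_
    filter_upwards [ae_pureError_pos (μ := μ) hd hv] with y hy
    rw [← ENNReal.ofReal_add (by positivity) (mul_nonneg (calibWeight_nonneg X y) (hH _)),
      ssLoss_eq_pureError_add, mul_add]
    congr 2
    rw [calibWeight_eq]
    field_simp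
  rw [h1, lintegral_add_left measurable_const, lintegral_const, measure_univ, mul_one, hloss,
    ← trace_treatmentHat, ← lintegral_quadForm_piGaussian _ _ hH]
  congr 1
  simp_rw [hfun]
  exact lintegral_calibWeight_mul hPH _
    (g := fun u => ∑ i, (u - treatmentHat X *ᵥ (modelMatrix f X *ᵥ t)) i ^ 2) (by fun_prop)

lemma isTarget_unweighted_iff (hdet : ((modelMatrix f X)ᵀ * modelMatrix f X).det ≠ 0)
    (t : Fin p → ℝ) :
    IsTarget (piGaussian (fun i => μ (X i)) v) (fun _ => 1) (ssLoss f X) t ↔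
      t = lsMatrix f X *ᵥ fun i => μ (X i) := by
  refine isTarget_iff_of_quadratic (posDef_gram hdet) (A := 0) (W := 1)
    (c := v * n + ssLoss f X (lsMatrix f X *ᵥ fun i => μ (X i)) fun i => μ (X i))
    (by simp) (by simp) (by simp) ?_ (fun s => ?_) t
  · have := ssLoss_nonneg f X (lsMatrix f X *ᵥ fun i => μ (X i)) fun i => μ (X i)
    positivity
  · rw [lintegral_ssLoss, ssLoss_eq_min_add hdet, zero_add, one_mul, add_assoc]

lemma isTarget_weighted_iff (hdet : ((modelMatrix f X)ᵀ * modelMatrix f X).det ≠ 0)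
    (hd : 2 < pureErrorDF X) (hv : 0 < v) (t : Fin p → ℝ) :
    IsTarget (piGaussian (fun i => μ (X i)) v) (calibWeight X) (ssLoss f X) t ↔
      t = lsMatrix f X *ᵥ fun i => μ (X i) := by
  have hd' : (2 : ℝ) < pureErrorDF X := by exact_mod_cast hd
  have hv' : (0 : ℝ) < v := hv
  refine isTarget_iff_of_quadratic (posDef_gram hdet) (A := ENNReal.ofReal ((pureErrorDF X : ℝ) / 2))
    (W := ∫⁻ y, ENNReal.ofReal (calibWeight X y) ∂(piGaussian (fun i => μ (X i)) v))
    (c := v * numTreatments X +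
      ssLoss f X (lsMatrix f X *ᵥ fun i => μ (X i)) fun i => μ (X i))
    ENNReal.ofReal_ne_top ?_ ?_ ?_ (fun s => ?_) t
  · rw [lintegral_calibWeight hd]; exact ENNReal.ofReal_ne_top
  · rw [lintegral_calibWeight hd]
    have : 0 < (pureErrorDF X : ℝ) - 2 := by linarith
    simp only [ne_eq, ENNReal.ofReal_eq_zero, not_le]
    positivity
  · have := ssLoss_nonneg f X (lsMatrix f X *ᵥ fun i => μ (X i)) fun i => μ (X i)
    positivity
  · rw [lintegral_calibWeight_mul_ssLoss (by omega) hv, ssLoss_eq_min_add hdet, add_assoc]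

/-- With one or two degrees of freedom the expected weighted loss is infinite. -/
lemma not_isTarget_weighted (hn : 0 < n) (hd : 0 < pureErrorDF X) (hd2 : pureErrorDF X ≤ 2)
    (hv : 0 < v) (t : Fin p → ℝ) :
    ¬ IsTarget (piGaussian (fun i => μ (X i)) v) (calibWeight X) (ssLoss f X) t := by
  intro h
  refine h.1 ?_
  have hv' : (0 : ℝ) < v := hv
  -- With at least one treatment the factor of the infinite mean weight is positive, so the product
  -- is not `0 * ∞`.
  have hq : (0 : ℝ) < numTreatments X := by exact_mod_cast numTreatments_pos X hn
  rw [lintegral_calibWeight_mul_ssLoss hd hv, lintegral_calibWeight_eq_top hd hd2 hv,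
    ENNReal.top_mul, add_top]
  have := ssLoss_nonneg f X t fun i => μ (X i)
  simp only [ne_eq, ENNReal.ofReal_eq_zero, not_le]
  positivity

end Target

/-! ### Conditional expected utilities given the hyper-variables. -/

section Utility

variable {𝕏 : Type*} {n p : ℕ} {X : Fin n → 𝕏} {f : 𝕏 → Fin p → ℝ} {μ : 𝕏 → ℝ} {v : ℝ≥0}

lemma calibWeight_pos (hd : 0 < pureErrorDF X) {y : Fin n → ℝ}
    (hy : 0 < quadForm (pureErrorProj X) y) : 0 < calibWeight X y := by
  rw [calibWeight_eq]; positivity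

lemma utilityNSE_eq (hdet : ((modelMatrix f X)ᵀ * modelMatrix f X).det ≠ 0)
    {y : Fin n → ℝ} (hw : 0 < calibWeight X y) (t : Fin p → ℝ) :
    utilityNSE (calibWeight X y) (fun s => ssLoss f X s y) (fun _ => 1) t =
      ((-quadForm 1 (t - lsMatrix f X *ᵥ y) : ℝ) : EReal) := by
  have hl := fun s => ssLoss_eq_min_add hdet s y
  rw [utilityNSE, if_pos ((gibbsPosteriorExists_quadratic (posDef_gram hdet) hl).2 hw),
    gibbsMean_quadratic (posDef_gram hdet) hl hw]

/-- The log density is written as an integrable part, random only through the log pure error, minus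
a nonnegative weighted distance. Only the latter can have infinite mean. -/
lemma utilitySH_eq (hdet : ((modelMatrix f X)ᵀ * modelMatrix f X).det ≠ 0)
    (hd : 0 < pureErrorDF X) {y : Fin n → ℝ} (hy : 0 < quadForm (pureErrorProj X) y)
    (t : Fin p → ℝ) :
    utilitySH (calibWeight X y) (fun s => ssLoss f X s y) (fun _ => 1) t =
      ((-((p : ℝ) / 2) * (Real.log (2 * Real.pi) - Real.log (pureErrorDF X) +
          Real.log (quadForm (pureErrorProj X) y)) +
        1 / 2 * Real.log ((modelMatrix f X)ᵀ * modelMatrix f X).det -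
        calibWeight X y * quadForm ((modelMatrix f X)ᵀ * modelMatrix f X)
          (t - lsMatrix f X *ᵥ y) : ℝ) : EReal) := by
  have hl := fun s => ssLoss_eq_min_add hdet s y
  have hw := calibWeight_pos hd hy
  have hlog : Real.log (Real.pi / calibWeight X y) = Real.log (2 * Real.pi) -
      Real.log (pureErrorDF X) + Real.log (quadForm (pureErrorProj X) y) := by
    have hd' : (0 : ℝ) < pureErrorDF X := by exact_mod_cast hd
    have := Real.pi_pos
    rw [← Real.log_div (by positivity) (by positivity), ← Real.log_mul (by positivity) hy.ne',
      calibWeight_eq]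
    congr 1
    field_simp
  rw [utilitySH, if_pos ((gibbsPosteriorExists_quadratic (posDef_gram hdet) hl).2 hw),
    log_gibbsPdf_quadratic (posDef_gram hdet) hl hw, hlog]
  congr 1
  ring

lemma calibWeight_eq_zero (hd : pureErrorDF X = 0) (y : Fin n → ℝ) : calibWeight X y = 0 := by
  rw [calibWeight_eq, hd]; simp

lemma utilityNSE_eq_bot (hd : pureErrorDF X = 0) (y : Fin n → ℝ) (t : Fin p → ℝ) :
    utilityNSE (calibWeight X y) (fun s => ssLoss f X s y) (fun _ => 1) t = ⊥ := by
  rw [utilityNSE, if_neg]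
  rintro ⟨h, -⟩
  rw [calibWeight_eq_zero hd] at h
  exact lt_irrefl _ h

lemma utilitySH_eq_bot (hd : pureErrorDF X = 0) (y : Fin n → ℝ) (t : Fin p → ℝ) :
    utilitySH (calibWeight X y) (fun s => ssLoss f X s y) (fun _ => 1) t = ⊥ := by
  rw [utilitySH, if_neg]
  rintro ⟨h, -⟩
  rw [calibWeight_eq_zero hd] at h
  exact lt_irrefl _ h

/-- The conditional expected NSE utility given the hyper-variables. -/
lemma hasExpectation_utilityNSE (hdet : ((modelMatrix f X)ᵀ * modelMatrix f X).det ≠ 0)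
    (hd : 0 < pureErrorDF X) (hv : 0 < v) :
    HasExpectation (piGaussian (fun i => μ (X i)) v)
      (fun y => utilityNSE (calibWeight X y) (fun s => ssLoss f X s y) (fun _ => 1)
        (lsMatrix f X *ᵥ fun i => μ (X i)))
      ((-(v * (((modelMatrix f X)ᵀ * modelMatrix f X)⁻¹).trace) : ℝ) : EReal) := by
  -- The form is centred at the mean vector, so there is no bias term and only the trace remains.
  obtain ⟨h1, h2⟩ := integral_quadForm_piGaussian (fun i => μ (X i)) (fun i => μ (X i)) v
    ((lsMatrix f X)ᵀ * (1 : Matrix (Fin p) (Fin p) ℝ) * lsMatrix f X)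
  rw [trace_lsMatrix_one hdet, sub_self, quadForm, zero_dotProduct, add_zero] at h2
  rw [← h2, ← integral_neg]
  refine (hasExpectation_coe h1.neg).congr_ae ?_
  filter_upwards [ae_pureError_pos (μ := μ) hd hv] with y hy
  rw [utilityNSE_eq hdet (calibWeight_pos hd hy), quadForm_lsMatrix]
  rfl

lemma integral_log_pureError (hd : 0 < pureErrorDF X) (hv : 0 < v) (a b c : ℝ) :
    Integrable (fun y => a * (b + Real.log (quadForm (pureErrorProj X) y)) + c)
      (piGaussian (fun i => μ (X i)) v) ∧
    ∫ y, (a * (b + Real.log (quadForm (pureErrorProj X) y)) + c)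
        ∂(piGaussian (fun i => μ (X i)) v) =
      a * (b + (Real.log v + (Real.log 2 +
        (Complex.digamma ((pureErrorDF X : ℂ) / 2)).re))) + c := by
  obtain ⟨h1, h2⟩ := integral_log_quadForm_piGaussian (pureErrorProj_transpose X)
    (pureErrorProj_idem X) (trace_pureErrorProj X) hd (pureErrorProj_mulVec X μ) hv
  have h3 := ((integrable_const b).add h1).const_mul a
  refine ⟨h3.add (integrable_const c), ?_⟩
  refine (integral_add h3 (integrable_const c)).trans ?_
  rw [integral_const_mul]
  refine congrArg₂ _ (congrArg _ ((integral_add (integrable_const b) h1).trans ?_)) (by simp)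
  rw [h2]
  simp

lemma measurable_weighted_distance : Measurable fun y : Fin n → ℝ => calibWeight X y *
    quadForm ((modelMatrix f X)ᵀ * modelMatrix f X)
      ((lsMatrix f X *ᵥ fun i => μ (X i)) - lsMatrix f X *ᵥ y) := by
  refine (measurable_calibWeight X).mul (Continuous.measurable ?_)
  fun_prop

lemma weighted_distance_nonneg (t : Fin p → ℝ) (y : Fin n → ℝ) : 0 ≤ calibWeight X y *
    quadForm ((modelMatrix f X)ᵀ * modelMatrix f X) (t - lsMatrix f X *ᵥ y) := by
  refine mul_nonneg (calibWeight_nonneg X y) ?_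
  rw [quadForm_transpose_mul_self]
  positivity

lemma lintegral_weighted_distance (hdet : ((modelMatrix f X)ᵀ * modelMatrix f X).det ≠ 0) :
    ∫⁻ y, ENNReal.ofReal (calibWeight X y * quadForm ((modelMatrix f X)ᵀ * modelMatrix f X)
      ((lsMatrix f X *ᵥ fun i => μ (X i)) - lsMatrix f X *ᵥ y))
      ∂(piGaussian (fun i => μ (X i)) v) =
    (∫⁻ y, ENNReal.ofReal (calibWeight X y) ∂(piGaussian (fun i => μ (X i)) v)) *
      ENNReal.ofReal (v * p) := by
  rw [lintegral_calibWeight_mul pureErrorProj_mul_lsMatrix_transpose _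
    (g := fun u => quadForm ((modelMatrix f X)ᵀ * modelMatrix f X)
      ((lsMatrix f X *ᵥ fun i => μ (X i)) - u)) (Continuous.measurable (by fun_prop))]
  congr 1
  simp_rw [quadForm_lsMatrix]
  rw [lintegral_quadForm_piGaussian, trace_lsMatrix_gram hdet, sub_self]
  · simp [quadForm]
  · intro u
    have := quadForm_lsMatrix (f := f) (X := X) ((modelMatrix f X)ᵀ * modelMatrix f X) u 0
    rw [sub_zero] at this
    rw [← this, quadForm_transpose_mul_self]
    positivity

/-- The conditional expected SH utility given the hyper-variables, with more than two degrees of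
freedom. -/
lemma hasExpectation_utilitySH (hdet : ((modelMatrix f X)ᵀ * modelMatrix f X).det ≠ 0)
    (hd : 2 < pureErrorDF X) (hv : 0 < v) :
    HasExpectation (piGaussian (fun i => μ (X i)) v)
      (fun y => utilitySH (calibWeight X y) (fun s => ssLoss f X s y) (fun _ => 1)
        (lsMatrix f X *ᵥ fun i => μ (X i)))
      ((-((p : ℝ) / 2) * (Real.log (2 * Real.pi) - Real.log (pureErrorDF X) +
          (Real.log v + (Real.log 2 + (Complex.digamma ((pureErrorDF X : ℂ) / 2)).re))) +
        1 / 2 * Real.log ((modelMatrix f X)ᵀ * modelMatrix f X).det -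
        (p : ℝ) / 2 * ((pureErrorDF X : ℝ) / ((pureErrorDF X : ℝ) - 2)) : ℝ) : EReal) := by
  have hd0 : 0 < pureErrorDF X := by omega
  obtain ⟨h1, h2⟩ := integral_log_pureError (X := X) (μ := μ) hd0 hv (-((p : ℝ) / 2))
    (Real.log (2 * Real.pi) - Real.log (pureErrorDF X))
    (1 / 2 * Real.log ((modelMatrix f X)ᵀ * modelMatrix f X).det)
  have hlin := lintegral_weighted_distance (μ := μ) (v := v) hdet
  rw [lintegral_calibWeight hd] at hlin
  have hmeas := measurable_weighted_distance (f := f) (X := X) (μ := μ)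
  have hnn := weighted_distance_nonneg (f := f) (X := X) (lsMatrix f X *ᵥ fun i => μ (X i))
  have h3 : Integrable _ (piGaussian (fun i => μ (X i)) v) :=
    (lintegral_ofReal_ne_top_iff_integrable hmeas.aestronglyMeasurable (.of_forall hnn)).1
      (by rw [hlin]; exact ENNReal.mul_ne_top ENNReal.ofReal_ne_top ENNReal.ofReal_ne_top)
  have h4 := integral_eq_lintegral_of_nonneg_ae (μ := piGaussian (fun i => μ (X i)) v)
    (.of_forall hnn) hmeas.aestronglyMeasurable
  have hd' : (0 : ℝ) < (pureErrorDF X : ℝ) - 2 := by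
    have : (2 : ℝ) < pureErrorDF X := by exact_mod_cast hd
    linarith
  have hv' : (0 : ℝ) < v := hv
  rw [hlin, ENNReal.toReal_mul, ENNReal.toReal_ofReal (by positivity),
    ENNReal.toReal_ofReal (by positivity)] at h4
  -- The factor `v⁻¹` of the mean weight cancels the variance of the estimate, so this term is free
  -- of `v`.
  have h5 : (pureErrorDF X : ℝ) / 2 * ((v : ℝ)⁻¹ * (1 / ((pureErrorDF X : ℝ) - 2))) * (v * p) =
      (p : ℝ) / 2 * ((pureErrorDF X : ℝ) / ((pureErrorDF X : ℝ) - 2)) := by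
    field_simp
  rw [← h5, ← h4, ← h2, ← integral_sub h1 h3]
  refine (hasExpectation_coe (h1.sub h3)).congr_ae ?_
  filter_upwards [ae_pureError_pos (μ := μ) hd0 hv] with y hy
  rw [utilitySH_eq hdet hd0 hy]
  rfl

/-- The conditional expected SH utility is `-∞` with one or two degrees of freedom. -/
lemma hasExpectation_utilitySH_bot (hp : 0 < p)
    (hdet : ((modelMatrix f X)ᵀ * modelMatrix f X).det ≠ 0) (hd : 0 < pureErrorDF X)
    (hd2 : pureErrorDF X ≤ 2) (hv : 0 < v) :
    HasExpectation (piGaussian (fun i => μ (X i)) v)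
      (fun y => utilitySH (calibWeight X y) (fun s => ssLoss f X s y) (fun _ => 1)
        (lsMatrix f X *ᵥ fun i => μ (X i))) ⊥ := by
  obtain ⟨h1, -⟩ := integral_log_pureError (X := X) (μ := μ) hd hv (-((p : ℝ) / 2))
    (Real.log (2 * Real.pi) - Real.log (pureErrorDF X))
    (1 / 2 * Real.log ((modelMatrix f X)ᵀ * modelMatrix f X).det)
  have hlin := lintegral_weighted_distance (μ := μ) (v := v) hdet
  have hvp : (0 : ℝ) < v * p := mul_pos hv (by exact_mod_cast hp)
  rw [lintegral_calibWeight_eq_top hd hd2 hv, ENNReal.top_mul (ENNReal.ofReal_pos.2 hvp).ne'] at hlin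
  refine (hasExpectation_bot_of_sub h1
    (measurable_weighted_distance (f := f) (X := X) (μ := μ)).aemeasurable
    (weighted_distance_nonneg _) hlin).congr_ae ?_
  filter_upwards [ae_pureError_pos (μ := μ) hd hv] with y hy
  rw [utilitySH_eq hdet hd hy]

lemma objectiveNSE_eq (hd : 0 < pureErrorDF X) :
    objectiveNSE f X =
      ((-(((modelMatrix f X)ᵀ * modelMatrix f X)⁻¹).trace : ℝ) : EReal) := by
  rw [objectiveNSE, h₁, if_neg hd.ne', mul_one, EReal.coe_neg]

lemma objectiveNSE_eq_bot (hp : 0 < p)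
    (hdet : ((modelMatrix f X)ᵀ * modelMatrix f X).det ≠ 0) (hd : pureErrorDF X = 0) :
    objectiveNSE f X = ⊥ := by
  have : Nonempty (Fin p) := ⟨⟨0, hp⟩⟩
  have htr : 0 < (((modelMatrix f X)ᵀ * modelMatrix f X)⁻¹).trace :=
    (posDef_gram hdet).inv.trace_pos
  rw [objectiveNSE, h₁, if_pos hd, ← EReal.coe_neg, EReal.coe_mul_top_of_neg (by linarith)]

lemma objectiveSH_eq_bot (hp : 0 < p) (hd : pureErrorDF X ≤ 2) : objectiveSH f X = ⊥ := by
  have hp' : (0 : ℝ) < p := by exact_mod_cast hp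
  rw [objectiveSH, h₂, if_pos hd, ← EReal.coe_neg, EReal.coe_mul_top_of_neg (by linarith),
    EReal.bot_add]

lemma objectiveSH_eq (hd : 2 < pureErrorDF X) :
    objectiveSH f X =
      ((-(p : ℝ) * ((Complex.digamma ((pureErrorDF X : ℂ) / 2)).re - Real.log (pureErrorDF X) +
          (pureErrorDF X : ℝ) / ((pureErrorDF X : ℝ) - 2)) +
        Real.log ((modelMatrix f X)ᵀ * modelMatrix f X).det : ℝ) : EReal) := by
  rw [objectiveSH, h₂, if_neg (by omega), ← EReal.coe_neg, ← EReal.coe_mul, ← EReal.coe_add]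

end Utility

/-! ### Averaging over the hyper-variables. -/

section ExpectedUtility

variable {𝕏 : Type*} {n p : ℕ} {X : Fin n → 𝕏} {f : 𝕏 → Fin p → ℝ} {C : Measure (HyperVar 𝕏)}

instance isProbabilityMeasure_designerDist (r : HyperVar 𝕏) :
    IsProbabilityMeasure (designerDist X r) := by
  unfold designerDist; infer_instance

/-- If the pure error degrees of freedom are positive, target values are almost surely the least
squares fits to the mean response. -/
lemma ae_target_eq (hp : 0 < p) [IsProbabilityMeasure C]
    (hκ_pos : ∀ᵐ r ∂C, 0 < HyperVar.kappa r)
    (hdet : ((modelMatrix f X)ᵀ * modelMatrix f X).det ≠ 0) (hd : 0 < pureErrorDF X)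
    {θ : HyperVar 𝕏 → Fin p → ℝ}
    (hθ : (∀ᵐ r ∂C, IsTarget (designerDist X r) (calibWeight X) (ssLoss f X) (θ r)) ∨
      ∀ᵐ r ∂C, IsTarget (designerDist X r) (fun _ => 1) (ssLoss f X) (θ r)) :
    ∀ᵐ r ∂C, θ r = lsMatrix f X *ᵥ fun i => HyperVar.mean r (X i) := by
  rcases hθ with hθ | hθ
  · filter_upwards [hθ, hκ_pos] with r h1 h2
    rcases le_or_gt (pureErrorDF X) 2 with hd2 | hd2
    · exact absurd h1
        (not_isTarget_weighted (pos_of_gram_det_ne_zero hp hdet) hd hd2 h2 (θ r))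
    · exact (isTarget_weighted_iff hdet hd2 h2 (θ r)).1 h1
  · filter_upwards [hθ] with r h1
    exact (isTarget_unweighted_iff hdet (θ r)).1 h1

/-- The conditional utility is linear in `κ`, so only the mean `σ` of `κ` enters. -/
lemma isGibbsExpectedNSE (hp : 0 < p) [IsProbabilityMeasure C]
    (hκ_pos : ∀ᵐ r ∂C, 0 < HyperVar.kappa r)
    (hκ_int : Integrable (fun r => (HyperVar.kappa r : ℝ)) C) {σ : ℝ} (hσ : 0 < σ)
    (hκσ : ∫ r, (HyperVar.kappa r : ℝ) ∂C = σ)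
    (hdet : ((modelMatrix f X)ᵀ * modelMatrix f X).det ≠ 0) {θ : HyperVar 𝕏 → Fin p → ℝ}
    (hθ : (∀ᵐ r ∂C, IsTarget (designerDist X r) (calibWeight X) (ssLoss f X) (θ r)) ∨
      ∀ᵐ r ∂C, IsTarget (designerDist X r) (fun _ => 1) (ssLoss f X) (θ r)) :
    IsGibbsExpectedNSE f C X θ ((σ : EReal) * objectiveNSE f X) := by
  rcases Nat.eq_zero_or_pos (pureErrorDF X) with hd | hd
  -- For `d = 0` the weight is 0, so the weighted criterion leaves `θ` arbitrary; this is harmless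
  -- because the utility is identically `-∞`.
  · rw [objectiveNSE_eq_bot hp hdet hd, EReal.coe_mul_bot_of_pos hσ]
    refine ⟨fun _ => ⊥, .of_forall fun r => ?_, hasExpectation_bot⟩
    simp_rw [utilityNSE_eq_bot hd]
    exact hasExpectation_bot
  · refine ⟨fun r => ((-((HyperVar.kappa r : ℝ) *
      (((modelMatrix f X)ᵀ * modelMatrix f X)⁻¹).trace) : ℝ) : EReal), ?_, ?_⟩
    · filter_upwards [ae_target_eq hp hκ_pos hdet hd hθ, hκ_pos] with r h1 h2
      rw [h1]
      exact hasExpectation_utilityNSE hdet hd h2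
    · have h := hasExpectation_coe (hκ_int.mul_const
        (((modelMatrix f X)ᵀ * modelMatrix f X)⁻¹).trace).neg
      rw [integral_neg', integral_mul_const, hκσ, ← mul_neg, EReal.coe_mul,
        ← objectiveNSE_eq hd] at h
      exact h

lemma isGibbsExpectedSH (hp : 0 < p) [IsProbabilityMeasure C]
    (hκ_pos : ∀ᵐ r ∂C, 0 < HyperVar.kappa r)
    (hlog : Integrable (fun r => Real.log (HyperVar.kappa r : ℝ)) C)
    (hdet : ((modelMatrix f X)ᵀ * modelMatrix f X).det ≠ 0) {θ : HyperVar 𝕏 → Fin p → ℝ}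
    (hθ : (∀ᵐ r ∂C, IsTarget (designerDist X r) (calibWeight X) (ssLoss f X) (θ r)) ∨
      ∀ᵐ r ∂C, IsTarget (designerDist X r) (fun _ => 1) (ssLoss f X) (θ r)) :
    IsGibbsExpectedSH f C X θ
      (((-((p : ℝ) / 2) * (Real.log (2 * Real.pi) +
          (∫ r, Real.log (HyperVar.kappa r : ℝ) ∂C) + Real.log 2) : ℝ) : EReal) +
        ((1 / 2 : ℝ) : EReal) * objectiveSH f X) := by
  rcases le_or_gt (pureErrorDF X) 2 with hd2 | hd2
  · rw [objectiveSH_eq_bot hp hd2, EReal.coe_mul_bot_of_pos (by norm_num), EReal.add_bot]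
    refine ⟨fun _ => ⊥, ?_, hasExpectation_bot⟩
    rcases Nat.eq_zero_or_pos (pureErrorDF X) with hd | hd
    · refine .of_forall fun r => ?_
      simp_rw [utilitySH_eq_bot hd]
      exact hasExpectation_bot
    · filter_upwards [ae_target_eq hp hκ_pos hdet hd hθ, hκ_pos] with r h1 h2
      rw [h1]
      exact hasExpectation_utilitySH_bot hp hdet hd hd2 h2
  · set a := Complex.digamma ((pureErrorDF X : ℂ) / 2)
    refine ⟨fun r => ((-((p : ℝ) / 2) * (Real.log (2 * Real.pi) - Real.log (pureErrorDF X) +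
          (Real.log (HyperVar.kappa r : ℝ) + (Real.log 2 + a.re))) +
        1 / 2 * Real.log ((modelMatrix f X)ᵀ * modelMatrix f X).det -
        (p : ℝ) / 2 * ((pureErrorDF X : ℝ) / ((pureErrorDF X : ℝ) - 2)) : ℝ) : EReal), ?_, ?_⟩
    · filter_upwards [ae_target_eq hp hκ_pos hdet (by omega) hθ, hκ_pos] with r h1 h2
      rw [h1]
      exact hasExpectation_utilitySH hdet hd2 h2
    · have h1 := hlog.const_mul (-((p : ℝ) / 2))
      -- All that does not depend on `r`; the remaining random term is `-(p/2) log κ`.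
      set b := -((p : ℝ) / 2) * (Real.log (2 * Real.pi) - Real.log (pureErrorDF X) +
          (Real.log 2 + a.re)) +
        1 / 2 * Real.log ((modelMatrix f X)ᵀ * modelMatrix f X).det -
        (p : ℝ) / 2 * ((pureErrorDF X : ℝ) / ((pureErrorDF X : ℝ) - 2)) with hb
      have h2 := hasExpectation_coe (h1.add (integrable_const b))
      simp only [Pi.add_apply] at h2
      rw [integral_add h1 (integrable_const b), integral_const_mul, integral_const, probReal_univ,
        one_smul] at h2
      convert h2 using 1
      · ext r
        congr 1
        rw [hb]; ring
      · rw [objectiveSH_eq hd2, ← EReal.coe_mul, ← EReal.coe_add]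
        congr 1
        rw [hb]; ring

end ExpectedUtility

end GibbsDesign

/-! ### The main theorem. -/

open GibbsDesign in
theorem mainTheorem1 {𝕏 : Type*} {p : ℕ} (hp : 0 < p) (f : 𝕏 → Fin p → ℝ)
    -- the hyper-variable distribution; the last hypothesis holds if `E_C(κ | σ²) = σ²`, and in
    -- particular if `σ²` is a constant and `E_C(κ) = σ²`
    (C : Measure (HyperVar 𝕏)) [IsProbabilityMeasure C]
    (hκ_pos : ∀ᵐ r ∂C, 0 < HyperVar.kappa r)
    (hκ_int : Integrable (fun r => (HyperVar.kappa r : ℝ)) C)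
    (hσ_int : Integrable (fun r => (HyperVar.sigmaSq r : ℝ)) C)
    (hκσ : ∫ r, (HyperVar.kappa r : ℝ) ∂C = ∫ r, (HyperVar.sigmaSq r : ℝ) ∂C) :
    0 < ∫ r, (HyperVar.sigmaSq r : ℝ) ∂C ∧
    ∀ (n : ℕ) (X : Fin n → 𝕏), ((modelMatrix f X)ᵀ * modelMatrix f X).det ≠ 0 →
      -- the target parameter values
      (∀ r : HyperVar 𝕏, 0 < HyperVar.kappa r → ∀ t : Fin p → ℝ,
        (2 < pureErrorDF X →
          (IsTarget (designerDist X r) (calibWeight X) (ssLoss f X) t ↔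
            t = ((modelMatrix f X)ᵀ * modelMatrix f X)⁻¹ *ᵥ
              ((modelMatrix f X)ᵀ *ᵥ fun i => HyperVar.mean r (X i)))) ∧
        (IsTarget (designerDist X r) (fun _ => 1) (ssLoss f X) t ↔
            t = ((modelMatrix f X)ᵀ * modelMatrix f X)⁻¹ *ᵥ
              ((modelMatrix f X)ᵀ *ᵥ fun i => HyperVar.mean r (X i)))) ∧
      -- the Gibbs expected utilities at the target parameter values
      ∀ θ : HyperVar 𝕏 → Fin p → ℝ,
        ((∀ᵐ r ∂C, IsTarget (designerDist X r) (calibWeight X) (ssLoss f X) (θ r)) ∨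
          (∀ᵐ r ∂C, IsTarget (designerDist X r) (fun _ => 1) (ssLoss f X) (θ r))) →
        IsGibbsExpectedNSE f C X θ
          (((∫ r, (HyperVar.sigmaSq r : ℝ) ∂C : ℝ) : EReal) * objectiveNSE f X) ∧
        (Integrable (fun r => Real.log (HyperVar.kappa r : ℝ)) C →
          IsGibbsExpectedSH f C X θ
            (((-((p : ℝ) / 2) * (Real.log (2 * Real.pi) +
                (∫ r, Real.log (HyperVar.kappa r : ℝ) ∂C) + Real.log 2) : ℝ) : EReal) +
              ((1 / 2 : ℝ) : EReal) * objectiveSH f X)) := by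

  -- Positivity is inherited from `κ`, which is almost surely positive and has the same mean.
  have hpos : 0 < ∫ r, (HyperVar.sigmaSq r : ℝ) ∂C := by
    rw [← hκσ, integral_pos_iff_support_of_nonneg (fun r => NNReal.coe_nonneg _) hκ_int]
    have : Function.support (fun r : HyperVar 𝕏 => (HyperVar.kappa r : ℝ)) =ᵐ[C] Set.univ := by
      filter_upwards [hκ_pos] with r hr
      exact eq_true (NNReal.coe_pos.2 hr).ne'
    rw [measure_congr this, measure_univ]
    exact zero_lt_one
  refine ⟨hpos, fun n X hdet => ⟨fun r hr t => ?_, fun θ hθ => ⟨?_, fun hlog => ?_⟩⟩⟩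
  · rw [← lsMatrix_mulVec]
    exact ⟨fun hd => isTarget_weighted_iff hdet hd hr t, isTarget_unweighted_iff hdet t⟩
  · exact isGibbsExpectedNSE hp hκ_pos hκ_int hpos hκσ hdet hθ
  · exact isGibbsExpectedSH hp hκ_pos hlog hdet hθ
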